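/- **Proposition 2.6 (Tilt-excess inequality).** Let $m,n\ge 1$. Write points of $\mathbb R^{m+n}=\mathbb R^m\times\mathbb R^n$ as $(x,y)$, let $B_r\subset\mathbb R^m$ be the open ball of radius $r$ centred at $0$, and let $\mathbf C_r=B_r\times\mathbb R^n$. There are constants $C>0$ and $\delta_0>0$, depending only on $m$ and $n$, with the following property. Assume that (i) $M$ is a smooth $m$-dimensional embedded submanifold contained in $\mathbf C_2$ which is $\delta$-flat in $\mathbf C_2$ for some $\delta\le\delta_0$, i.e. $M$ is the graph $\{(x,g(x)):x\in B_2\}$ of a map $g\in C^2(B_2,\mathbb R^n)$ with $\tfrac12|g(x)|+|Dg(x)|+2|D^2g(x)|\le\delta$ for all $x\in B_2$; (ii) $V$ is an $m$-dimensional stationary integer rectifiable varifold in $\mathbf C_1$ with $\operatorname{supp}(V)\subset\{(x,y):|x|<1,\ |y|<1\}$. That is, the weight $\|V\|=\Theta\,\mathcal H^m\llcorner A$ is a Radon measure on $\mathbf C_1$, where $A\subset\mathbf C_1$ is a countably $m$-rectifiable Borel set and $\Theta$ is Borel with positive integer values; $T_zV$ denotes the approximate tangent plane, defined for $\|V\|$-a.e.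 $z$; and $\int \operatorname{div}_{T_zV}X\,d\|V\|(z)=0$ for every $X\in C_c^\infty(\mathbf C_1,\mathbb R^{m+n})$. Let $d_M$ be the distance to $M$, $\mathrm{II}$ the second fundamental form of $M$, and $H_M$ its mean curvature vector (the trace of $\mathrm{II}$). For $m$-planes $S,T$ let $|S-T|$ be the Hilbert–Schmidt norm of the difference of the orthogonal projections onto $S$ and $T$; $|\mathrm{II}|$ is also the Hilbert–Schmidt norm. Let $D_Vf(z)$ denote the gradient at $z$ of $f|_{z+T_zV}$, and let $\Delta_Vf(z)$ be the trace of $D^2f(z)$ on $T_zV$. Then every point $z$ of $\{|x|<1,|y|<1\}$ has a unique closest point $p(z)\in M$, and: 1. for $\|V\|$-a.e. $z$, $d_M$ restricted to $z+T_zV$ is differentiable at $z$ and $$|T_zV-T_{p(z)}M|^2\ \ge\ |D_Vd_M|^2(z);$$ 2. for $\|V\|$-a.e. $z$, $d_M^2$ is $C^\infty$ near $z$ and $$\Delta_V\tfrac12d_M^2(z)\ \ge\ \tfrac14|T_zV-T_{p(z)}M|^2-|H_M(p(z))|\,d_M(z)-2|\mathrm{II}(p(z))|\,d_M(z)^2;$$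 3. as an inequality in $[0,\infty]$, $$\int_{\mathbf C_{1/2}}|T_zV-T_{p(z)}M|^2\,d\|V\|(z)\ \le\ C\int_{\mathbf C_1}\big(d_M^2+d_M\,|H_M\circ p|\big)\,d\|V\|.$$ -/

import Mathlib

open MeasureTheory Filter Topology Set
open scoped ENNReal ContDiff

noncomputable section

/-! ### Planes in a Euclidean space -/

section Planes

variable {E : Type*} [NormedAddCommGroup E] [InnerProductSpace ℝ E] [FiniteDimensional ℝ E]

/-- `|S - T|²`: the squared Hilbert–Schmidt norm of the difference of the orthogonal projections
onto the linear subspaces `S` and `T`. -/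
def planeDistSq (S T : Submodule ℝ E) : ℝ :=
  ∑ i, ‖S.starProjection (stdOrthonormalBasis ℝ E i)
    - T.starProjection (stdOrthonormalBasis ℝ E i)‖ ^ 2

/-- `div_T X (z) = tr (P_T ∘ DX(z))`, the divergence of the vector field `X` along the
subspace `T`. -/
def divAlong (T : Submodule ℝ E) (X : E → E) (z : E) : ℝ :=
  LinearMap.trace ℝ E ((T.starProjection ∘L fderiv ℝ X z : E →L[ℝ] E) : E →ₗ[ℝ] E)

/-- `Δ_T f (z) = tr (P_T ∘ D²f(z))`, the Laplacian of `f` along the subspace `T`. -/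
def laplacianAlong (T : Submodule ℝ E) (f : E → ℝ) (z : E) : ℝ :=
  divAlong T (gradient f) z

/-- `f` is differentiable at `z` along the subspace `T`: the restriction of `f` to the affine plane
`z + T` is differentiable at `z`. -/
def DifferentiableAlong (T : Submodule ℝ E) (f : E → ℝ) (z : E) : Prop :=
  DifferentiableAt ℝ (fun v : T => f (z + v)) 0

/-- The gradient at `z` of the restriction of `f` to the affine plane `z + T`. -/
def gradientAlong (T : Submodule ℝ E) (f : E → ℝ) (z : E) : T :=
  gradient (fun v : T => f (z + v)) 0

end Planes

/-! ### Geometry of a submanifold `M` of a Euclidean space -/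

section Submanifold

variable {E : Type*} [NormedAddCommGroup E] [InnerProductSpace ℝ E] [FiniteDimensional ℝ E]

/-- The tangent space `T_q M`. -/
def tangentPlane (M : Set E) (q : E) : Submodule ℝ E :=
  Submodule.span ℝ (tangentConeAt ℝ M q)

/-- The second fundamental form `II(u, v) = (D_u v)^⊥` at `q ∈ M`, for `u, v ∈ T_q M`; the vector
`v` is extended to the tangent vector field `w ↦ P_{T_w M} v` on `M`, which is differentiated along
`M` in the tangent direction `u`. (The value of a derivative within `M` on vectors of `T_q M` does
not depend on the choice of the derivative.) -/
def secondFundamentalForm (M : Set E) (q u v : E) : E :=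
  (tangentPlane M q)ᗮ.starProjection
    (fderivWithin ℝ (fun w => (tangentPlane M w).starProjection v) M q u)

/-- The mean curvature vector `H_M(q)`, the trace of the second fundamental form. -/
def meanCurvature (M : Set E) (q : E) : E :=
  ∑ i, secondFundamentalForm M q
    (stdOrthonormalBasis ℝ (tangentPlane M q) i) (stdOrthonormalBasis ℝ (tangentPlane M q) i)

/-- The Hilbert–Schmidt norm `|II|` of the second fundamental form at `q`. -/
def secondFundamentalFormNorm (M : Set E) (q : E) : ℝ :=
  √(∑ i, ∑ j, ‖secondFundamentalForm M q
    (stdOrthonormalBasis ℝ (tangentPlane M q) i)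
    (stdOrthonormalBasis ℝ (tangentPlane M q) j)‖ ^ 2)

/-- `q` is a closest point of `M` to `z`. -/
def IsClosestPoint (M : Set E) (z q : E) : Prop :=
  q ∈ M ∧ dist z q = Metric.infDist z M

open Classical in
/-- The closest-point projection `p` onto `M` (with value `0` where no closest point exists). -/
def closestPoint (M : Set E) (z : E) : E :=
  if h : ∃ q, IsClosestPoint M z q then h.choose else 0

end Submanifold

/-! ### Integer rectifiable varifolds -/

section Varifold

variable {E : Type*} [NormedAddCommGroup E] [InnerProductSpace ℝ E] [FiniteDimensional ℝ E]
  [MeasurableSpace E] [BorelSpace E]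

/-- The `m`-dimensional Hausdorff measure with the Euclidean normalization: the factor is the
Lebesgue measure of a ball of diameter one in `ℝ^m`. -/
def hausdorff (E : Type*) [NormedAddCommGroup E] [InnerProductSpace ℝ E]
    [MeasurableSpace E] [BorelSpace E] (m : ℕ) : Measure E :=
  volume (Metric.ball (0 : EuclideanSpace ℝ (Fin m)) (1 / 2)) • μH[(m : ℝ)]

/-- `A` is countably `m`-rectifiable: up to an `H^m`-null set it is covered by countably many
Lipschitz images of `ℝ^m`. -/
def IsCountablyRectifiable (m : ℕ) (A : Set E) : Prop :=
  ∃ f : ℕ → EuclideanSpace ℝ (Fin m) → E,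
    (∀ k, ∃ K, LipschitzWith K (f k)) ∧ hausdorff E m (A \ ⋃ k, range (f k)) = 0

/-- The measure `Θ H^m ⌞ A`. -/
def weightedHausdorff (m : ℕ) (A : Set E) (Θ : E → ℕ) : Measure E :=
  ((hausdorff E m).restrict A).withDensity (fun z => (Θ z : ℝ≥0∞))

/-- `T` is the approximate tangent plane at `z` of the measure `μ`, with multiplicity `θ`: the
rescalings `r^{-m} (w ↦ (w - z) / r)_# μ` converge to `θ H^m ⌞ T` as `r ↓ 0`, tested with continuous
functions of compact support. -/
def IsApproxTangent (m : ℕ) (μ : Measure E) (θ : ℝ) (z : E) (T : Submodule ℝ E) : Prop :=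
  ∀ φ : E → ℝ, Continuous φ → HasCompactSupport φ →
    Tendsto (fun r : ℝ => (r ^ m)⁻¹ * ∫ w, φ (r⁻¹ • (w - z)) ∂μ) (𝓝[>] 0)
      (𝓝 (θ * ∫ w in (T : Set E), φ w ∂(hausdorff E m)))

/-- An `m`-dimensional integer rectifiable varifold in the open set `U`: the Radon measure
`Θ H^m ⌞ A` on `U`, with `A ⊆ U` rectifiable and `Θ` Borel with positive integer values, together
with the (measurable) field of its approximate tangent planes. Equivalently, it is the Radon measure
on `U × G_m` whose marginal on `U` is `Θ H^m ⌞ A` and whose disintegration is the Dirac mass at the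
approximate tangent plane. -/
structure IntegralVarifold (m : ℕ) (U : Set E) where
  /-- the rectifiable set `A` -/
  carrier : Set E
  /-- the multiplicity `Θ` -/
  density : E → ℕ
  /-- the tangent planes `T_z V` -/
  tangent : E → Submodule ℝ E
  measurableSet_carrier : MeasurableSet carrier
  carrier_subset : carrier ⊆ U
  rectifiable : IsCountablyRectifiable m carrier
  measurable_density : Measurable density
  density_pos : ∀ z ∈ carrier, 0 < density z
  finite_on_compacts : ∀ K ⊆ U, IsCompact K → weightedHausdorff m carrier density K < ⊤
  finrank_tangent : ∀ z, Module.finrank ℝ (tangent z) = m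
  measurable_tangent : ∀ v : E, Measurable fun z => (tangent z).starProjection v
  isApproxTangent : ∀ᵐ z ∂weightedHausdorff m carrier density,
    IsApproxTangent m (weightedHausdorff m carrier density) (density z) z (tangent z)

namespace IntegralVarifold

variable {m : ℕ} {U : Set E}

/-- The weight measure `‖V‖ = Θ H^m ⌞ A`. -/
def weight (V : IntegralVarifold m U) : Measure E :=
  weightedHausdorff m V.carrier V.density

/-- The support of `V` in `U`. -/
def supp (V : IntegralVarifold m U) : Set E := U ∩ V.weight.support

/-- `V` is stationary in `U`: its first variation `δV(X) = ∫ div_{T_z V} X d‖V‖` vanishes for every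
smooth vector field `X` with compact support in `U`. -/
def IsStationary (V : IntegralVarifold m U) : Prop :=
  ∀ X : E → E, ContDiff ℝ ∞ X → HasCompactSupport X → tsupport X ⊆ U →
    ∫ z, divAlong (V.tangent z) X z ∂V.weight = 0

end IntegralVarifold

end Varifold

/-! ### The space `ℝ^m × ℝ^n`, cylinders and flat submanifolds -/

/-- `ℝ^{m+n} = ℝ^m × ℝ^n` with the Euclidean norm. -/
abbrev Ambient (m n : ℕ) : Type :=
  WithLp 2 (EuclideanSpace ℝ (Fin m) × EuclideanSpace ℝ (Fin n))

/-- The open cylinder `C_r = B_r × ℝ^n`. -/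
def openCylinder (m n : ℕ) (r : ℝ) : Set (Ambient m n) := {z | ‖z.fst‖ < r}

/-- `B_1(0, π₀) + B_1(0, π₀^⊥) = {(x, y) : |x| < 1, |y| < 1}`. -/
def unitSlab (m n : ℕ) : Set (Ambient m n) := {z | ‖z.fst‖ < 1 ∧ ‖z.snd‖ < 1}

/-- `M` is an `m`-dimensional smooth (embedded) submanifold of `ℝ^m × ℝ^n`: near each of its points
a smooth diffeomorphism between open sets straightens it to `ℝ^m × {0}`. -/
def IsSmoothSubmanifold {m n : ℕ} (M : Set (Ambient m n)) : Prop :=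
  ∀ q ∈ M, ∃ Ψ : OpenPartialHomeomorph (Ambient m n) (Ambient m n),
    q ∈ Ψ.source ∧ ContDiffOn ℝ ∞ Ψ Ψ.source ∧ ContDiffOn ℝ ∞ Ψ.symm Ψ.target ∧
      ∀ w ∈ Ψ.source, w ∈ M ↔ (Ψ w).snd = 0

/-- `M` is `δ`-flat in `C_r`: `M ∩ C_r` is the graph of a map `g ∈ C²(B_r, ℝ^n)` with
`r⁻¹ |g| + |Dg| + r |D²g| ≤ δ` on `B_r`. -/
def IsFlatIn {m n : ℕ} (δ : ℝ) (M : Set (Ambient m n)) (r : ℝ) : Prop :=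
  ∃ g : EuclideanSpace ℝ (Fin m) → EuclideanSpace ℝ (Fin n),
    ContDiffOn ℝ 2 g (Metric.ball 0 r) ∧
    M ∩ openCylinder m n r = {z | ‖z.fst‖ < r ∧ z.snd = g z.fst} ∧
    ∀ x ∈ Metric.ball (0 : EuclideanSpace ℝ (Fin m)) r,
      r⁻¹ * ‖g x‖ + ‖fderiv ℝ g x‖ + r * ‖fderiv ℝ (fderiv ℝ g) x‖ ≤ δ

end

noncomputable section

/-!
Near the slab the closest-point projection `p` is smooth and `d_M² / 2` has gradient `z - p z`, so
`Δ_V (d_M² / 2)` is the trace of `1 - Dp` over `T_z V`. Differentiating the orthogonality of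
`z - p z` to `M` shows that `L = Dp` solves `L = P_S + B L`, where `S = T_{p z} M` and `B` is the
shape operator in the direction `z - p z`; as `tr B = ⟪H, z - p z⟫` and `|B| ≤ |II| d_M`, comparing
the traces of `1 - P_S` and `B L` over `T_z V` gives the lower bound for the Laplacian.

For the gradient bound, off `M` the gradient of `d_M` is a unit normal `ν ⟂ S`, and
`P_T ν = (P_T - P_S) ν`; on `M` the approximate tangent planes of `V` and of `M` agree almost
everywhere, so `d_M` has derivative `0` along `T_z V`.

The tilt-excess inequality follows by testing stationarity with `ζ² (z - p z)` for a cylindrical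
cutoff `ζ` and absorbing the cross term by Cauchy–Schwarz, since `|P_T (z - p z)|` is bounded by
`|T - S| d_M`.
-/

section Trace

variable {E : Type*} [NormedAddCommGroup E] [InnerProductSpace ℝ E]

/-- The trace of a continuous endomorphism, as a linear functional; on continuous endomorphisms
`*` is composition. -/
def clmTrace (E : Type*) [NormedAddCommGroup E] [NormedSpace ℝ E] : (E →L[ℝ] E) →ₗ[ℝ] ℝ :=
  LinearMap.trace ℝ E ∘ₗ ContinuousLinearMap.coeLM ℝ

theorem clmTrace_mul_comm (A B : E →L[ℝ] E) : clmTrace E (A * B) = clmTrace E (B * A) :=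
  LinearMap.trace_mul_comm ℝ (A : E →ₗ[ℝ] E) (B : E →ₗ[ℝ] E)

theorem clmTrace_eq_sum_inner {ι : Type*} [Fintype ι] (b : OrthonormalBasis ι ℝ E)
    (A : E →L[ℝ] E) : clmTrace E A = ∑ i, inner ℝ (b i) (A (b i)) :=
  LinearMap.trace_eq_sum_inner _ b

theorem sum_norm_sq_eq_clmTrace_mul_self {ι : Type*} [Fintype ι] (b : OrthonormalBasis ι ℝ E)
    {A : E →L[ℝ] E} (hA : (A : E →ₗ[ℝ] E).IsSymmetric) :
    ∑ i, ‖A (b i)‖ ^ 2 = clmTrace E (A * A) := by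
  rw [clmTrace_eq_sum_inner b]
  refine Finset.sum_congr rfl fun i _ => ?_
  rw [← real_inner_self_eq_norm_sq]
  exact hA (b i) (A (b i))

theorem clmTrace_mul_mul_le {ι : Type*} [Fintype ι] (b : OrthonormalBasis ι ℝ E)
    {A C : E →L[ℝ] E} (hA : (A : E →ₗ[ℝ] E).IsSymmetric) {c : ℝ} (hC : ∀ v, ‖C v‖ ≤ c * ‖v‖) :
    clmTrace E (A * (C * A)) ≤ c * clmTrace E (A * A) := by
  rw [← sum_norm_sq_eq_clmTrace_mul_self b hA, Finset.mul_sum, clmTrace_eq_sum_inner b]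
  refine Finset.sum_le_sum fun i _ => ?_
  calc inner ℝ (b i) (A (C (A (b i)))) = inner ℝ (A (b i)) (C (A (b i))) := (hA _ _).symm
    _ ≤ ‖A (b i)‖ * ‖C (A (b i))‖ := real_inner_le_norm _ _
    _ ≤ ‖A (b i)‖ * (c * ‖A (b i)‖) := by gcongr; exact hC _
    _ = c * ‖A (b i)‖ ^ 2 := by ring

theorem norm_sq_le_sum_norm_sq_mul {F ι : Type*} [NormedAddCommGroup F] [InnerProductSpace ℝ F]
    [Fintype ι] (b : OrthonormalBasis ι ℝ E) (A : E →L[ℝ] F) (v : E) :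
    ‖A v‖ ^ 2 ≤ (∑ i, ‖A (b i)‖ ^ 2) * ‖v‖ ^ 2 := by
  have hv : A v = ∑ i, inner ℝ (b i) v • A (b i) := by
    conv_lhs => rw [← b.sum_repr' v]
    simp only [map_sum, map_smul]
  have hnorm : ‖A v‖ ≤ ∑ i, ‖A (b i)‖ * ‖inner ℝ (b i) v‖ := by
    rw [hv]
    refine (norm_sum_le _ _).trans_eq (Finset.sum_congr rfl fun i _ => ?_)
    rw [norm_smul, mul_comm]
  calc ‖A v‖ ^ 2 ≤ (∑ i, ‖A (b i)‖ * ‖inner ℝ (b i) v‖) ^ 2 := by gcongr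
    _ ≤ (∑ i, ‖A (b i)‖ ^ 2) * ∑ i, ‖inner ℝ (b i) v‖ ^ 2 := Finset.sum_mul_sq_le_sq_mul_sq _ _ _
    _ = _ := by rw [b.sum_sq_norm_inner_right]

variable [FiniteDimensional ℝ E]

theorem clmTrace_smulRight (ℓ : E →L[ℝ] ℝ) (v : E) : clmTrace E (ℓ.smulRight v) = ℓ v :=
  LinearMap.trace_smulRight (ℓ : E →ₗ[ℝ] ℝ) v

theorem clmTrace_eq_sum_inner_of_forall_mem {T : Submodule ℝ E} {A : E →L[ℝ] E}
    (hA : ∀ v, A v ∈ T) {ι : Type*} [Fintype ι] (t : OrthonormalBasis ι ℝ T) :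
    clmTrace E A = ∑ i, inner ℝ (t i : E) (A (t i)) :=
  (LinearMap.trace_restrict_eq_of_forall_mem T (A : E →ₗ[ℝ] E) hA).symm.trans
    (LinearMap.trace_eq_sum_inner _ t)

theorem clmTrace_starProjection_mul {T : Submodule ℝ E} {ι : Type*} [Fintype ι]
    (t : OrthonormalBasis ι ℝ T) (A : E →L[ℝ] E) :
    clmTrace E (T.starProjection * A) = ∑ i, inner ℝ (t i : E) (A (t i)) := by
  rw [clmTrace_eq_sum_inner_of_forall_mem (fun v => T.starProjection_apply_mem (A v)) t]
  refine Finset.sum_congr rfl fun i _ => ?_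
  calc inner ℝ (t i : E) (T.starProjection (A (t i)))
      = inner ℝ (T.starProjection (t i)) (A (t i)) :=
        (T.inner_starProjection_left_eq_right _ _).symm
    _ = _ := by rw [Submodule.starProjection_eq_self_iff.mpr (t i).2]

theorem clmTrace_starProjection (T : Submodule ℝ E) :
    clmTrace E T.starProjection = Module.finrank ℝ T := by
  rw [← mul_one T.starProjection, clmTrace_starProjection_mul (stdOrthonormalBasis ℝ T)]
  have ht (i) : ‖(stdOrthonormalBasis ℝ T i : E)‖ = 1 := (stdOrthonormalBasis ℝ T).norm_eq_one i
  simp [ht]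

theorem clmTrace_starProjection_mul_nonneg (T : Submodule ℝ E) {A : E →L[ℝ] E}
    (hA : ∀ v, 0 ≤ inner ℝ v (A v)) : 0 ≤ clmTrace E (T.starProjection * A) := by
  rw [clmTrace_starProjection_mul (stdOrthonormalBasis ℝ T)]
  exact Finset.sum_nonneg fun i _ => hA _

end Trace

section PlaneDistance

variable {E : Type*} [NormedAddCommGroup E] [InnerProductSpace ℝ E] [FiniteDimensional ℝ E]

theorem planeDistSq_nonneg (S T : Submodule ℝ E) : 0 ≤ planeDistSq S T :=
  Finset.sum_nonneg fun _ _ => sq_nonneg _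

theorem planeDistSq_eq_clmTrace (S T : Submodule ℝ E) :
    planeDistSq S T = Module.finrank ℝ S + Module.finrank ℝ T
      - 2 * clmTrace E (S.starProjection * T.starProjection) := by
  have hsymm : ((S.starProjection - T.starProjection : E →L[ℝ] E) : E →ₗ[ℝ] E).IsSymmetric :=
    S.starProjection_isSymmetric.sub T.starProjection_isSymmetric
  calc planeDistSq S T = clmTrace E
        ((S.starProjection - T.starProjection) * (S.starProjection - T.starProjection)) :=
        sum_norm_sq_eq_clmTrace_mul_self (stdOrthonormalBasis ℝ E) hsymm
    _ = _ := by
        rw [mul_sub, sub_mul, sub_mul, S.isIdempotentElem_starProjection.eq,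
          T.isIdempotentElem_starProjection.eq]
        simp only [map_sub, clmTrace_starProjection]
        rw [clmTrace_mul_comm T.starProjection]
        ring

theorem finrank_sub_clmTrace_eq_planeDistSq {S T : Submodule ℝ E}
    (hST : Module.finrank ℝ S = Module.finrank ℝ T) :
    Module.finrank ℝ T - clmTrace E (T.starProjection * S.starProjection) =
      planeDistSq T S / 2 := by
  rw [planeDistSq_eq_clmTrace, hST]
  ring

theorem norm_starProjection_sub_sq_le (S T : Submodule ℝ E) (v : E) :
    ‖S.starProjection v - T.starProjection v‖ ^ 2 ≤ planeDistSq S T * ‖v‖ ^ 2 :=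
  norm_sq_le_sum_norm_sq_mul (stdOrthonormalBasis ℝ E) (S.starProjection - T.starProjection) v

theorem norm_starProjection_sq_le_planeDistSq_mul {S : Submodule ℝ E} (T : Submodule ℝ E) {v : E}
    (hv : v ∈ Sᗮ) : ‖T.starProjection v‖ ^ 2 ≤ planeDistSq T S * ‖v‖ ^ 2 := by
  have h := norm_starProjection_sub_sq_le T S v
  rwa [(Submodule.starProjection_apply_eq_zero_iff S).mpr hv, sub_zero] at h

end PlaneDistance

section ShapeOperator

variable {E : Type*} [NormedAddCommGroup E] [InnerProductSpace ℝ E] [FiniteDimensional ℝ E]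
  {S T : Submodule ℝ E} {B L : E →L[ℝ] E} {κ : ℝ}

theorem starProjection_mul_eq_self (hS : ∀ v, B v ∈ S) : S.starProjection * B = B :=
  ContinuousLinearMap.ext fun v => Submodule.starProjection_eq_self_iff.mpr (hS v)

theorem mul_starProjection_eq_self (hB : (B : E →ₗ[ℝ] E).IsSymmetric) (hS : ∀ v, B v ∈ S) :
    B * S.starProjection = B := by
  have hstar : star B = B := hB.isSelfAdjoint.star_eq
  have h := congrArg star (starProjection_mul_eq_self hS)
  rwa [star_mul, (isSelfAdjoint_starProjection S).star_eq, hstar] at h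

theorem abs_inner_self_apply_le_of_forall_mem (hB : (B : E →ₗ[ℝ] E).IsSymmetric)
    (hS : ∀ v, B v ∈ S) (hBκ : ∀ v, ‖B v‖ ≤ κ * ‖v‖) (v : E) :
    |inner ℝ v (B v)| ≤ κ * inner ℝ v (S.starProjection v) := by
  set P := S.starProjection
  have hPP : inner ℝ v (P v) = ‖P v‖ ^ 2 := by
    rw [← real_inner_self_eq_norm_sq, S.inner_starProjection_left_eq_right,
      Submodule.starProjection_eq_self_iff.mpr (S.starProjection_apply_mem v)]
  have hPB : inner ℝ v (B v) = inner ℝ (P v) (B (P v)) := by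
    rw [S.inner_starProjection_left_eq_right]
    change _ = inner ℝ v ((P * (B * P)) v)
    rw [mul_starProjection_eq_self hB hS, starProjection_mul_eq_self hS]
  rw [hPP, hPB]
  calc |inner ℝ (P v) (B (P v))| ≤ ‖P v‖ * ‖B (P v)‖ := abs_real_inner_le_norm _ _
    _ ≤ ‖P v‖ * (κ * ‖P v‖) := by gcongr; exact hBκ _
    _ = κ * ‖P v‖ ^ 2 := by ring

/-- `B` acts on `S`, so the defect lives on `Tᗮ`, where `κ P_S + B ≥ 0` compares it with the trace
of `P_S` on `Tᗮ`, which is half of `|T - S|²`. -/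
theorem clmTrace_starProjection_mul_le (hST : Module.finrank ℝ S = Module.finrank ℝ T)
    (hB : (B : E →ₗ[ℝ] E).IsSymmetric) (hS : ∀ v, B v ∈ S) (hBκ : ∀ v, ‖B v‖ ≤ κ * ‖v‖) :
    clmTrace E (T.starProjection * B) ≤ clmTrace E B + κ * (planeDistSq T S / 2) := by
  have hnonneg : 0 ≤ clmTrace E (Tᗮ.starProjection * (κ • S.starProjection + B)) :=
    clmTrace_starProjection_mul_nonneg _ fun v => by
      have := neg_abs_le (inner ℝ v (B v))
      have := abs_inner_self_apply_le_of_forall_mem hB hS hBκ v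
      simp only [add_apply, smul_apply, inner_add_right, inner_smul_right]
      linarith
  rw [Submodule.starProjection_orthogonal', mul_add, mul_smul_comm, sub_mul, sub_mul, one_mul,
    one_mul, map_add, map_smul, map_sub, map_sub, clmTrace_starProjection, hST,
    finrank_sub_clmTrace_eq_planeDistSq hST, smul_eq_mul] at hnonneg
  linarith

theorem norm_apply_le_of_eq_starProjection_add (hL : L = S.starProjection + B * L)
    (hBκ : ∀ v, ‖B v‖ ≤ κ * ‖v‖) (hκ : κ ≤ 1 / 2) (v : E) : ‖L v‖ ≤ 2 * ‖v‖ := by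
  have hLv : L v = S.starProjection v + B (L v) := DFunLike.congr_fun hL v
  have hadd : ‖L v‖ ≤ ‖S.starProjection v‖ + ‖B (L v)‖ := by
    conv_lhs => rw [hLv]
    exact norm_add_le _ _
  have hP : ‖S.starProjection v‖ ≤ ‖v‖ := S.norm_starProjection_apply_le v
  have hBL : ‖B (L v)‖ ≤ 1 / 2 * ‖L v‖ := (hBκ _).trans (by gcongr)
  linarith

/-- With `B = II(·, ·) · (z - p(z))` the shape operator, `L = (1 - B)⁻¹ P_S` is the derivative of
the closest-point projection at `z`, and `1 - L` is the Hessian of half the squared distance. -/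
theorem clmTrace_starProjection_mul_one_sub_ge (hST : Module.finrank ℝ S = Module.finrank ℝ T)
    (hB : (B : E →ₗ[ℝ] E).IsSymmetric) (hS : ∀ v, B v ∈ S) (hL : L = S.starProjection + B * L)
    (hκ : κ ≤ 1 / 2) (hκ0 : 0 ≤ κ) (hBκ : clmTrace E (B * B) ≤ κ ^ 2) :
    planeDistSq T S / 4 - clmTrace E B - 2 * κ ^ 2 ≤
      clmTrace E (T.starProjection * (1 - L)) := by
  set b := stdOrthonormalBasis ℝ E
  set P := S.starProjection
  set Q := T.starProjection
  have hnB (v) : ‖B v‖ ≤ κ * ‖v‖ := by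
    refine le_of_sq_le_sq ?_ (by positivity)
    calc ‖B v‖ ^ 2 ≤ (∑ i, ‖B (b i)‖ ^ 2) * ‖v‖ ^ 2 := norm_sq_le_sum_norm_sq_mul b B v
      _ ≤ (κ * ‖v‖) ^ 2 := by rw [sum_norm_sq_eq_clmTrace_mul_self b hB, mul_pow]; gcongr
  have hexpand : L = P + B + B * (B * L) := by
    conv_lhs => rw [hL, hL, mul_add, mul_starProjection_eq_self hB hS]
    rw [add_assoc]
  have hsplit : clmTrace E (Q * (1 - L)) = planeDistSq T S / 2 - clmTrace E (Q * B) -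
      clmTrace E (Q * (B * (B * L))) := by
    conv_lhs => rw [hexpand]
    simp only [mul_sub, mul_add, mul_one, map_sub, map_add]
    rw [clmTrace_starProjection, ← finrank_sub_clmTrace_eq_planeDistSq hST]
    ring
  have hlinear : clmTrace E (Q * B) ≤ clmTrace E B + κ * (planeDistSq T S / 2) :=
    clmTrace_starProjection_mul_le hST hB hS hnB
  have hquadratic : clmTrace E (Q * (B * (B * L))) ≤ 2 * κ ^ 2 := by
    have hLQ (v) : ‖(L * Q) v‖ ≤ 2 * ‖v‖ :=
      (norm_apply_le_of_eq_starProjection_add hL hnB hκ (Q v)).trans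
        (by gcongr; exact T.norm_starProjection_apply_le v)
    calc clmTrace E (Q * (B * (B * L))) = clmTrace E (B * ((L * Q) * B)) := by
          rw [← mul_assoc, clmTrace_mul_comm, mul_assoc, ← mul_assoc L]
      _ ≤ 2 * clmTrace E (B * B) := clmTrace_mul_mul_le b hB hLQ
      _ ≤ 2 * κ ^ 2 := by gcongr
  have hκ_half : κ * (planeDistSq T S / 2) ≤ 1 / 2 * (planeDistSq T S / 2) := by
    have := planeDistSq_nonneg T S
    gcongr
  linarith

end ShapeOperator

section LocalInverse

theorem injective_fderiv_of_eventually_leftInverse {E F : Type*} [NormedAddCommGroup E]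
    [NormedSpace ℝ E] [NormedAddCommGroup F] [NormedSpace ℝ F] {f : E → F} {h : F → E} {q : E}
    (hf : DifferentiableAt ℝ f q) (hh : DifferentiableAt ℝ h (f q))
    (hhf : ∀ᶠ w in 𝓝 q, h (f w) = w) : Function.Injective (fderiv ℝ f q) := by
  have hcomp : fderiv ℝ h (f q) ∘L fderiv ℝ f q = ContinuousLinearMap.id ℝ E :=
    (hh.hasFDerivAt.comp q hf.hasFDerivAt).unique ((hasFDerivAt_id q).congr_of_eventuallyEq hhf)
  exact Function.LeftInverse.injective (g := fderiv ℝ h (f q)) fun v => DFunLike.congr_fun hcomp v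

theorem contDiffAt_of_eventually_apply_eq {X Y Z : Type*} [NormedAddCommGroup X] [NormedSpace ℝ X]
    [CompleteSpace X] [NormedAddCommGroup Y] [NormedSpace ℝ Y] [CompleteSpace Y]
    [NormedAddCommGroup Z] [NormedSpace ℝ Z] [CompleteSpace Z] {k : WithTop ℕ∞} {F : X × Y → Z}
    {g : X → Y} {x : X} (hF : ContDiffAt ℝ k F (x, g x)) (hk : k ≠ 0)
    (hF' : (fderiv ℝ F (x, g x) ∘L .inr ℝ X Y).IsInvertible) (hg : ContinuousAt g x)
    (hFg : ∀ᶠ y in 𝓝 x, F (y, g y) = F (x, g x)) : ContDiffAt ℝ k g x := by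
  refine (hF.contDiffAt_implicitFunction hk hF').congr_of_eventuallyEq ?_
  filter_upwards [hFg, (continuousAt_id.prodMk hg).eventually
    (hF.eventually_apply_eq_iff_implicitFunction hk hF')] with y hy hiff
  exact (hiff.mp hy).symm

end LocalInverse

/-- The parametrization `x ↦ (x, g x)` of the graph of `g`. -/
def graphMap {X Y : Type*} (g : X → Y) (x : X) : WithLp 2 (X × Y) :=
  WithLp.toLp 2 (x, g x)

@[simp] theorem graphMap_fst {X Y : Type*} (g : X → Y) (x : X) : (graphMap g x).fst = x := rfl

@[simp] theorem graphMap_snd {X Y : Type*} (g : X → Y) (x : X) : (graphMap g x).snd = g x := rfl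

theorem withLp_prod_ext {X Y : Type*} {z w : WithLp 2 (X × Y)} (h₁ : z.fst = w.fst)
    (h₂ : z.snd = w.snd) : z = w :=
  WithLp.ofLp_injective 2 (Prod.ext h₁ h₂)

theorem norm_le_norm_fst_add_norm_snd {X Y : Type*} [SeminormedAddCommGroup X]
    [SeminormedAddCommGroup Y] (z : WithLp 2 (X × Y)) : ‖z‖ ≤ ‖z.fst‖ + ‖z.snd‖ := by
  refine le_of_sq_le_sq ?_ (by positivity)
  rw [WithLp.prod_norm_sq_eq_of_L2, add_sq]
  linarith [mul_nonneg (norm_nonneg z.fst) (norm_nonneg z.snd)]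

section Graph

variable {X Y : Type*} [NormedAddCommGroup X] [NormedSpace ℝ X]
  [NormedAddCommGroup Y] [NormedSpace ℝ Y]

/-- The linear map `a ↦ (a, Dg(x) a)`, the derivative of `graphMap g` at `x`. -/
def graphDeriv (g : X → Y) (x : X) : X →L[ℝ] WithLp 2 (X × Y) :=
  (WithLp.prodContinuousLinearEquiv 2 ℝ X Y).symm ∘L
    (ContinuousLinearMap.id ℝ X).prod (fderiv ℝ g x)

theorem contDiff_toLp_prod {k : WithTop ℕ∞} :
    ContDiff ℝ k (fun z : X × Y => WithLp.toLp 2 z) :=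
  (WithLp.prodContinuousLinearEquiv 2 ℝ X Y).symm.contDiff

theorem hasFDerivAt_graphMap {g : X → Y} {x : X} (hg : DifferentiableAt ℝ g x) :
    HasFDerivAt (graphMap g) (graphDeriv g x) x :=
  (WithLp.prodContinuousLinearEquiv 2 ℝ X Y).symm.hasFDerivAt.comp x
    ((hasFDerivAt_id x).prodMk hg.hasFDerivAt)

theorem contDiffAt_graphMap {g : X → Y} {x : X} {k : WithTop ℕ∞} (hg : ContDiffAt ℝ k g x) :
    ContDiffAt ℝ k (graphMap g) x :=
  contDiff_toLp_prod.contDiffAt.comp x (contDiffAt_id.prodMk hg)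

theorem graphDeriv_injective (g : X → Y) (x : X) : Function.Injective (graphDeriv g x) :=
  Function.LeftInverse.injective (g := WithLp.fst) fun _ => rfl

theorem finrank_range_graphDeriv (g : X → Y) (x : X) :
    Module.finrank ℝ (graphDeriv g x).range = Module.finrank ℝ X :=
  LinearMap.finrank_range_of_inj (graphDeriv_injective g x)

theorem tangentConeAt_graph_subset {g : X → Y} {x : X} {M : Set (WithLp 2 (X × Y))}
    (hg : DifferentiableAt ℝ g x) (hM : ∀ w ∈ M, w.snd = g w.fst) :
    tangentConeAt ℝ M (graphMap g x) ⊆ (graphDeriv g x).range := by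
  intro u hu
  have hdefect : HasFDerivAt (fun w : WithLp 2 (X × Y) => w.snd - g w.fst)
      (WithLp.sndL 2 ℝ X Y - fderiv ℝ g x ∘L WithLp.fstL 2 ℝ X Y) (graphMap g x) :=
    (WithLp.sndL 2 ℝ X Y).hasFDerivAt.sub
      (HasFDerivAt.comp (g := g) _ hg.hasFDerivAt (WithLp.fstL 2 ℝ X Y).hasFDerivAt)
  have hzero : HasFDerivWithinAt (fun w : WithLp 2 (X × Y) => w.snd - g w.fst)
      (0 : WithLp 2 (X × Y) →L[ℝ] Y) M (graphMap g x) :=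
    (hasFDerivWithinAt_const (0 : Y) _ _).congr (fun w hw => by rw [hM w hw, sub_self]) (by simp)
  have hu' : u.snd - fderiv ℝ g x u.fst = 0 := hdefect.hasFDerivWithinAt.unique_on hzero hu
  exact ⟨u.fst, withLp_prod_ext rfl (sub_eq_zero.mp hu').symm⟩

theorem range_graphDeriv_subset_tangentConeAt {g : X → Y} {x : X} {M : Set (WithLp 2 (X × Y))}
    (hg : DifferentiableAt ℝ g x) (hM : ∀ᶠ y in 𝓝 x, graphMap g y ∈ M) :
    ((graphDeriv g x).range : Set (WithLp 2 (X × Y))) ⊆ tangentConeAt ℝ M (graphMap g x) := by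
  rintro _ ⟨a, rfl⟩
  have hcone : tangentConeAt ℝ {y | graphMap g y ∈ M} x = univ := tangentConeAt_of_mem_nhds hM
  exact tangentConeAt_mono (image_subset_iff.mpr fun y hy => hy)
    ((hasFDerivAt_graphMap hg).hasFDerivWithinAt.mapsTo_tangent_cone (hcone ▸ mem_univ a))

theorem tangentPlane_graph {X Y : Type*} [NormedAddCommGroup X] [InnerProductSpace ℝ X]
    [NormedAddCommGroup Y] [InnerProductSpace ℝ Y] {g : X → Y} {r : ℝ} {x : X} (hx : ‖x‖ < r)
    (hg : DifferentiableAt ℝ g x) :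
    tangentPlane {z : WithLp 2 (X × Y) | ‖z.fst‖ < r ∧ z.snd = g z.fst} (graphMap g x) =
      (graphDeriv g x).range := by
  refine le_antisymm ?_ ?_
  · exact Submodule.span_le.mpr (tangentConeAt_graph_subset hg fun w hw => hw.2)
  · refine (range_graphDeriv_subset_tangentConeAt hg ?_).trans Submodule.subset_span
    filter_upwards [continuous_norm.continuousAt.eventually_lt_const hx] with y hy
    exact ⟨hy, rfl⟩

theorem injective_snd_apply_vertical [FiniteDimensional ℝ X] {g : X → Y} {x : X}
    {D : WithLp 2 (X × Y) →L[ℝ] WithLp 2 (X × Y)} (hD : Function.Injective D)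
    (hgraph : ∀ a, (D (graphDeriv g x a)).snd = 0) :
    Function.Injective fun y : Y => (D (WithLp.toLp 2 (0, y))).snd := by
  set vertical : Y →L[ℝ] WithLp 2 (X × Y) :=
    (WithLp.prodContinuousLinearEquiv 2 ℝ X Y).symm ∘L .inr ℝ X Y
  change Function.Injective (WithLp.sndL 2 ℝ X Y ∘L D ∘L vertical)
  refine (injective_iff_map_eq_zero _).mpr fun y (hy : (D (vertical y)).snd = 0) => ?_
  -- `D` maps the tangent space of the graph injectively, hence onto, `X × 0`.
  set horizontal : X →ₗ[ℝ] X := (WithLp.fstL 2 ℝ X Y ∘L D ∘L graphDeriv g x).toLinearMap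
  have hsurj : Function.Surjective horizontal :=
    LinearMap.injective_iff_surjective.mp fun a b hab => graphDeriv_injective g x
      (hD (withLp_prod_ext hab (by rw [hgraph, hgraph])))
  obtain ⟨a, ha⟩ := hsurj (D (vertical y)).fst
  have heq : graphDeriv g x a = vertical y := hD (withLp_prod_ext ha (by rw [hgraph, hy]))
  have ha0 : a = 0 := congrArg WithLp.fst heq
  simpa [ha0, vertical] using (congrArg WithLp.snd heq).symm

variable [FiniteDimensional ℝ X] [FiniteDimensional ℝ Y]

theorem contDiffAt_of_straightening {k : WithTop ℕ∞} (hk : k ≠ 0) {g : X → Y} {x : X}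
    (hg : DifferentiableAt ℝ g x) {Ψ Ψ' : WithLp 2 (X × Y) → WithLp 2 (X × Y)}
    (hΨ : ContDiffAt ℝ k Ψ (graphMap g x)) (hΨ' : DifferentiableAt ℝ Ψ' (Ψ (graphMap g x)))
    (hleft : ∀ᶠ w in 𝓝 (graphMap g x), Ψ' (Ψ w) = w)
    (hgraph : ∀ᶠ y in 𝓝 x, (Ψ (graphMap g y)).snd = 0) : ContDiffAt ℝ k g x := by
  set e := (WithLp.prodContinuousLinearEquiv 2 ℝ X Y).symm
  set D := fderiv ℝ Ψ (graphMap g x)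
  have hD : HasFDerivAt Ψ D (graphMap g x) := (hΨ.differentiableAt hk).hasFDerivAt
  have hDinj : Function.Injective D :=
    injective_fderiv_of_eventually_leftInverse hD.differentiableAt hΨ' hleft
  have htangent : WithLp.sndL 2 ℝ X Y ∘L D ∘L graphDeriv g x = 0 :=
    ((WithLp.sndL 2 ℝ X Y).hasFDerivAt.comp x (hD.comp x (hasFDerivAt_graphMap hg))).unique
      ((hasFDerivAt_const (0 : Y) x).congr_of_eventuallyEq hgraph)
  set F : X × Y → Y := fun p => (Ψ (e p)).snd
  have hF : ContDiffAt ℝ k F (x, g x) := (WithLp.sndL 2 ℝ X Y).contDiff.contDiffAt.comp (x, g x)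
    (ContDiffAt.comp (x, g x) (g := Ψ) hΨ e.contDiff.contDiffAt)
  have hF' : fderiv ℝ F (x, g x) = WithLp.sndL 2 ℝ X Y ∘L D ∘L (e : X × Y →L[ℝ] _) :=
    ((WithLp.sndL 2 ℝ X Y).hasFDerivAt.comp (x, g x)
      (HasFDerivAt.comp (x, g x) (g := Ψ) hD e.hasFDerivAt)).fderiv
  have hinj : Function.Injective (fderiv ℝ F (x, g x) ∘L .inr ℝ X Y) := by
    rw [hF']
    exact injective_snd_apply_vertical hDinj (DFunLike.congr_fun htangent)
  refine contDiffAt_of_eventually_apply_eq hF hk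
    ⟨(LinearEquiv.ofInjectiveEndo _ hinj).toContinuousLinearEquiv, rfl⟩ hg.continuousAt ?_
  filter_upwards [hgraph] with y hy
  exact hy.trans hgraph.self_of_nhds.symm

theorem contDiffOn_of_graph_straightened {g : X → Y} {r : ℝ}
    {M : Set (WithLp 2 (X × Y))} (hMg : M = {z | ‖z.fst‖ < r ∧ z.snd = g z.fst})
    (hM : ∀ q ∈ M, ∃ Ψ : OpenPartialHomeomorph (WithLp 2 (X × Y)) (WithLp 2 (X × Y)),
      q ∈ Ψ.source ∧ ContDiffOn ℝ ∞ Ψ Ψ.source ∧ ContDiffOn ℝ ∞ Ψ.symm Ψ.target ∧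
        ∀ w ∈ Ψ.source, w ∈ M ↔ (Ψ w).snd = 0)
    (hg : DifferentiableOn ℝ g (Metric.ball 0 r)) : ContDiffOn ℝ ∞ g (Metric.ball 0 r) := by
  intro x hx
  have hball : Metric.ball 0 r ∈ 𝓝 x := Metric.isOpen_ball.mem_nhds hx
  have hmem : ∀ y ∈ Metric.ball (0 : X) r, graphMap g y ∈ M := fun y hy => by
    rw [hMg]
    exact ⟨mem_ball_zero_iff.mp hy, rfl⟩
  have hgx : DifferentiableAt ℝ g x := hg.differentiableAt hball
  obtain ⟨Ψ, hxΨ, hΨ, hΨ', hiff⟩ := hM _ (hmem x hx)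
  have hsource : Ψ.source ∈ 𝓝 (graphMap g x) := Ψ.open_source.mem_nhds hxΨ
  have htarget : Ψ.target ∈ 𝓝 (Ψ (graphMap g x)) := Ψ.open_target.mem_nhds (Ψ.map_source hxΨ)
  refine (contDiffAt_of_straightening (by simp) hgx (hΨ.contDiffAt hsource)
    ((hΨ'.contDiffAt htarget).differentiableAt (by simp)) (Ψ.eventually_left_inverse hxΨ)
    ?_).contDiffWithinAt
  filter_upwards [(hasFDerivAt_graphMap hgx).continuousAt hsource, hball] with y hyΨ hy
  exact (hiff _ hyΨ).mp (hmem y hy)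

end Graph

section ClosestPoint

variable {E : Type*} [NormedAddCommGroup E] {M : Set E} {z q : E}

theorem IsClosestPoint.dist_le (hq : IsClosestPoint M z q) {w : E} (hw : w ∈ M) :
    dist z q ≤ dist z w :=
  hq.2.trans_le (Metric.infDist_le_dist_of_mem hw)

theorem isClosestPoint_iff : IsClosestPoint M z q ↔ q ∈ M ∧ ∀ w ∈ M, dist z q ≤ dist z w := by
  refine ⟨fun h => ⟨h.1, fun w => h.dist_le⟩, fun ⟨hq, h⟩ => ⟨hq, le_antisymm ?_ ?_⟩⟩
  · exact (Metric.le_infDist ⟨q, hq⟩).mpr fun w hw => h w hw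
  · exact Metric.infDist_le_dist_of_mem hq

theorem isClosestPoint_closestPoint (h : ∃ q, IsClosestPoint M z q) :
    IsClosestPoint M z (closestPoint M z) := by
  rw [closestPoint, dif_pos h]
  exact h.choose_spec

theorem isClosestPoint_self (hq : q ∈ M) : IsClosestPoint M q q :=
  ⟨hq, by rw [dist_self, Metric.infDist_zero_of_mem hq]⟩

theorem closestPoint_eq_self (hq : q ∈ M) : closestPoint M q = q := by
  have h := (isClosestPoint_closestPoint ⟨q, isClosestPoint_self hq⟩).2
  rw [Metric.infDist_zero_of_mem hq, dist_eq_zero] at h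
  exact h.symm

end ClosestPoint

theorem hasFDerivAt_norm_sq_div_two {E F : Type*} [NormedAddCommGroup E] [NormedSpace ℝ E]
    [NormedAddCommGroup F] [InnerProductSpace ℝ F] {f : E → F} {L : E →L[ℝ] F} {z : E}
    (hf : HasFDerivAt f L z) :
    HasFDerivAt (fun w => ‖f w‖ ^ 2 / 2) (innerSL ℝ (f z) ∘L L) z := by
  simpa [div_eq_inv_mul, ← Nat.cast_smul_eq_nsmul ℝ, smul_smul] using hf.norm_sq.const_mul (2⁻¹ : ℝ)

/-- The closest-point projection onto `M` is defined and smooth on the open set `U`: the regularity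
that a tubular neighbourhood of a smooth submanifold `M` enjoys. -/
structure HasSmoothProjection {E : Type*} [NormedAddCommGroup E] [InnerProductSpace ℝ E]
    (M U : Set E) : Prop where
  isOpen : IsOpen U
  isClosestPoint : ∀ z ∈ U, IsClosestPoint M z (closestPoint M z)
  contDiffOn : ContDiffOn ℝ ∞ (closestPoint M) U

namespace HasSmoothProjection

variable {E : Type*} [NormedAddCommGroup E] [InnerProductSpace ℝ E] {M U : Set E} {z q : E}

theorem mem_nhds (h : HasSmoothProjection M U) (hz : z ∈ U) : U ∈ 𝓝 z :=
  h.isOpen.mem_nhds hz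

theorem closestPoint_mem (h : HasSmoothProjection M U) (hz : z ∈ U) : closestPoint M z ∈ M :=
  (h.isClosestPoint z hz).1

theorem infDist_eq (h : HasSmoothProjection M U) (hz : z ∈ U) :
    Metric.infDist z M = ‖z - closestPoint M z‖ := by
  rw [← (h.isClosestPoint z hz).2, dist_eq_norm]

theorem norm_sub_closestPoint_le (h : HasSmoothProjection M U) (hz : z ∈ U) (hq : q ∈ M) :
    ‖z - closestPoint M z‖ ≤ ‖z - q‖ := by
  simpa only [dist_eq_norm] using (h.isClosestPoint z hz).dist_le hq

theorem contDiffAt (h : HasSmoothProjection M U) (hz : z ∈ U) :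
    ContDiffAt ℝ ∞ (closestPoint M) z :=
  h.contDiffOn.contDiffAt (h.mem_nhds hz)

theorem hasFDerivAt (h : HasSmoothProjection M U) (hz : z ∈ U) :
    HasFDerivAt (closestPoint M) (fderiv ℝ (closestPoint M) z) z :=
  ((h.contDiffAt hz).differentiableAt (by simp)).hasFDerivAt

theorem hasFDerivAt_fderiv (h : HasSmoothProjection M U) (hz : z ∈ U) :
    HasFDerivAt (fderiv ℝ (closestPoint M)) (fderiv ℝ (fderiv ℝ (closestPoint M)) z) z :=
  (((h.contDiffAt hz).fderiv_right (m := 1) (by norm_cast)).differentiableAt (by simp)).hasFDerivAt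

theorem hasFDerivAt_fderiv_apply (h : HasSmoothProjection M U) (hz : z ∈ U) (v : E) :
    HasFDerivAt (fun w => fderiv ℝ (closestPoint M) w v)
      ((fderiv ℝ (fderiv ℝ (closestPoint M)) z).flip v) z :=
  (ContinuousLinearMap.apply ℝ E v).hasFDerivAt.comp z (h.hasFDerivAt_fderiv hz)

theorem eventually_closestPoint_mem (h : HasSmoothProjection M U) (hz : z ∈ U)
    (hpz : closestPoint M z ∈ U) : ∀ᶠ w in 𝓝 z, w ∈ U ∧ closestPoint M w ∈ U :=
  (h.isOpen.eventually_mem hz).and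
    ((h.hasFDerivAt hz).continuousAt.eventually (h.isOpen.eventually_mem hpz))

theorem contDiffAt_infDist_sq_div_two (h : HasSmoothProjection M U) (hz : z ∈ U) :
    ContDiffAt ℝ ∞ (fun w => Metric.infDist w M ^ 2 / 2) z := by
  refine (((contDiffAt_id.sub (h.contDiffAt hz)).norm_sq ℝ).div_const 2).congr_of_eventuallyEq ?_
  filter_upwards [h.isOpen.eventually_mem hz] with w hw
  rw [h.infDist_eq hw]
  rfl

section Complete

variable [CompleteSpace E]

/-- `d_M² / 2` lies below `‖w - p(z)‖² / 2`, with equality at `w = z`. -/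
theorem hasGradientAt_infDist_sq_div_two (h : HasSmoothProjection M U) (hz : z ∈ U) :
    HasGradientAt (fun w => Metric.infDist w M ^ 2 / 2) (z - closestPoint M z) z := by
  have hdist : (fun w => Metric.infDist w M ^ 2 / 2) =ᶠ[𝓝 z]
      fun w => ‖w - closestPoint M w‖ ^ 2 / 2 := by
    filter_upwards [h.isOpen.eventually_mem hz] with w hw
    rw [h.infDist_eq hw]
  have hmoving := hasFDerivAt_norm_sq_div_two ((hasFDerivAt_id z).sub (h.hasFDerivAt hz))
  have hfixed := hasFDerivAt_norm_sq_div_two ((hasFDerivAt_id z).sub_const (closestPoint M z))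
  have hmax : IsLocalMax (fun w => ‖w - closestPoint M w‖ ^ 2 / 2
      - ‖w - closestPoint M z‖ ^ 2 / 2) z := by
    filter_upwards [h.isOpen.eventually_mem hz] with w hw
    have := h.norm_sub_closestPoint_le hw (h.closestPoint_mem hz)
    rw [sub_self, sub_nonpos]
    gcongr
  have heq := sub_eq_zero.mp (hmax.hasFDerivAt_eq_zero (hmoving.sub hfixed))
  rw [heq, ContinuousLinearMap.comp_id] at hmoving
  exact hasGradientAt_iff_hasFDerivAt.mpr (hmoving.congr_of_eventuallyEq hdist)

/-- `1 - Dp` is the Hessian of `d_M² / 2`. -/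
theorem isSymmetric_fderiv (h : HasSmoothProjection M U) (hz : z ∈ U) :
    (fderiv ℝ (closestPoint M) z : E →ₗ[ℝ] E).IsSymmetric := by
  intro u v
  have hgrad : fderiv ℝ (fun w => Metric.infDist w M ^ 2 / 2) =ᶠ[𝓝 z]
      fun w => innerSL ℝ (w - closestPoint M w) := by
    filter_upwards [h.isOpen.eventually_mem hz] with w hw
    exact (h.hasGradientAt_infDist_sq_div_two hw).hasFDerivAt.fderiv
  have hhess : HasFDerivAt (fderiv ℝ (fun w => Metric.infDist w M ^ 2 / 2))
      (innerSL ℝ ∘L (.id ℝ E - fderiv ℝ (closestPoint M) z)) z :=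
    ((innerSL ℝ).hasFDerivAt.comp z
      ((hasFDerivAt_id z).sub (h.hasFDerivAt hz))).congr_of_eventuallyEq hgrad
  have hsymm : inner ℝ (u - fderiv ℝ (closestPoint M) z u) v =
      inner ℝ (v - fderiv ℝ (closestPoint M) z v) u := by
    have := ((h.contDiffAt_infDist_sq_div_two hz).isSymmSndFDerivAt (by simp; norm_cast)) u v
    rwa [hhess.fderiv] at this
  rw [inner_sub_left, inner_sub_left, real_inner_comm u v, real_inner_comm u] at hsymm
  exact sub_right_injective hsymm

end Complete

/-- `p` maps `U` into `M`, so its derivative is tangent to `M`. -/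
theorem fderiv_apply_mem_tangentConeAt (h : HasSmoothProjection M U) (hz : z ∈ U) (v : E) :
    fderiv ℝ (closestPoint M) z v ∈ tangentConeAt ℝ M (closestPoint M z) := by
  have hv : v ∈ tangentConeAt ℝ U z := by
    rw [tangentConeAt_of_mem_nhds (h.isOpen.mem_nhds hz)]
    exact mem_univ v
  refine tangentConeAt_mono ?_ ((h.hasFDerivAt hz).hasFDerivWithinAt.mapsTo_tangent_cone hv)
  exact image_subset_iff.mpr fun w hw => h.closestPoint_mem hw

theorem fderiv_apply_mem_tangentPlane (h : HasSmoothProjection M U) (hz : z ∈ U) (v : E) :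
    fderiv ℝ (closestPoint M) z v ∈ tangentPlane M (closestPoint M z) :=
  Submodule.subset_span (h.fderiv_apply_mem_tangentConeAt hz v)

theorem fderiv_apply_of_mem_tangentPlane (h : HasSmoothProjection M U) (hqM : q ∈ M) (hq : q ∈ U)
    {u : E} (hu : u ∈ tangentPlane M q) : fderiv ℝ (closestPoint M) q u = u := by
  have hid : HasFDerivWithinAt (closestPoint M) (.id ℝ E) M q :=
    (hasFDerivWithinAt_id q M).congr (fun w hw => closestPoint_eq_self hw)
      (closestPoint_eq_self hqM)
  have hcone : tangentConeAt ℝ M q ⊆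
      LinearMap.eqLocus (fderiv ℝ (closestPoint M) q : E →ₗ[ℝ] E) LinearMap.id :=
    (h.hasFDerivAt hq).hasFDerivWithinAt.unique_on hid
  exact Submodule.span_le.mpr hcone hu

theorem sub_closestPoint_mem_orthogonal (h : HasSmoothProjection M U) (hz : z ∈ U)
    (hpz : closestPoint M z ∈ U) : z - closestPoint M z ∈ (tangentPlane M (closestPoint M z))ᗮ := by
  set q := closestPoint M z
  have hfix : closestPoint M q = q := closestPoint_eq_self (h.closestPoint_mem hz)
  have hmin : IsLocalMin (fun w => ‖z - closestPoint M w‖ ^ 2 / 2) q := by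
    filter_upwards [h.isOpen.eventually_mem hpz] with w hw
    rw [hfix]
    gcongr
    exact h.norm_sub_closestPoint_le hz (h.closestPoint_mem hw)
  have hzero := hmin.hasFDerivAt_eq_zero
    (hasFDerivAt_norm_sq_div_two ((h.hasFDerivAt hpz).const_sub z))
  refine (Submodule.mem_orthogonal' _ _).mpr fun u hu => ?_
  have := DFunLike.congr_fun hzero u
  simpa [hfix, h.fderiv_apply_of_mem_tangentPlane (q := q) (h.closestPoint_mem hz) hpz hu,
    inner_sub_left, sub_eq_zero, eq_comm] using this

variable [FiniteDimensional ℝ E]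

theorem fderiv_eq_starProjection (h : HasSmoothProjection M U) (hqM : q ∈ M) (hq : q ∈ U) :
    fderiv ℝ (closestPoint M) q = (tangentPlane M q).starProjection := by
  ext u
  refine (Submodule.eq_starProjection_of_mem_orthogonal ?_ ?_).symm
  · have := h.fderiv_apply_mem_tangentConeAt hq u
    rw [closestPoint_eq_self hqM] at this
    exact Submodule.subset_span this
  · refine (Submodule.mem_orthogonal _ _).mpr fun t ht => ?_
    have hsymm : inner ℝ (fderiv ℝ (closestPoint M) q t) u =
      inner ℝ t (fderiv ℝ (closestPoint M) q u) := h.isSymmetric_fderiv hq t u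
    rw [inner_sub_right, ← hsymm, h.fderiv_apply_of_mem_tangentPlane hqM hq ht, sub_self]

theorem fderiv_closestPoint_eq_starProjection (h : HasSmoothProjection M U) (hz : z ∈ U)
    (hpz : closestPoint M z ∈ U) : fderiv ℝ (closestPoint M) (closestPoint M z) =
      (tangentPlane M (closestPoint M z)).starProjection :=
  h.fderiv_eq_starProjection (h.closestPoint_mem hz) hpz

end HasSmoothProjection

namespace HasSmoothProjection

variable {E : Type*} [NormedAddCommGroup E] [InnerProductSpace ℝ E] {M U : Set E} {z q : E}

theorem fderiv_fderiv_comm (h : HasSmoothProjection M U) (hq : q ∈ U) (u v : E) :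
    fderiv ℝ (fderiv ℝ (closestPoint M)) q u v = fderiv ℝ (fderiv ℝ (closestPoint M)) q v u :=
  (h.contDiffAt hq).isSymmSndFDerivAt (by simp; norm_cast) u v

theorem inner_fderiv_fderiv_comm [CompleteSpace E] (h : HasSmoothProjection M U) (hq : q ∈ U)
    (u a b : E) : inner ℝ (fderiv ℝ (fderiv ℝ (closestPoint M)) q u a) b =
      inner ℝ a (fderiv ℝ (fderiv ℝ (closestPoint M)) q u b) := by
  have hsymm : (fun w => innerSL ℝ b (fderiv ℝ (closestPoint M) w a)) =ᶠ[𝓝 q]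
      fun w => innerSL ℝ a (fderiv ℝ (closestPoint M) w b) := by
    filter_upwards [h.isOpen.eventually_mem hq] with w hw
    exact (real_inner_comm _ _).trans (h.isSymmetric_fderiv hw a b)
  have hleft := (innerSL ℝ b).hasFDerivAt.comp q (h.hasFDerivAt_fderiv_apply hq a)
  have hright := (innerSL ℝ a).hasFDerivAt.comp q (h.hasFDerivAt_fderiv_apply hq b)
  rw [real_inner_comm]
  exact DFunLike.congr_fun (hleft.unique (hright.congr_of_eventuallyEq hsymm)) u

variable [FiniteDimensional ℝ E]

/-- The derivative of `P_{p(w)} P_{p(w)} = P_{p(w)}` at `w = q`. -/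
theorem fderiv_fderiv_add_starProjection (h : HasSmoothProjection M U) (hqM : q ∈ M) (hq : q ∈ U)
    {u : E} (hu : u ∈ tangentPlane M q) (v : E) :
    fderiv ℝ (fderiv ℝ (closestPoint M)) q u ((tangentPlane M q).starProjection v)
      + (tangentPlane M q).starProjection (fderiv ℝ (fderiv ℝ (closestPoint M)) q u v) =
        fderiv ℝ (fderiv ℝ (closestPoint M)) q u v := by
  have hfix : closestPoint M q = q := closestPoint_eq_self hqM
  have hplanes : HasFDerivAt (fun w => fderiv ℝ (closestPoint M) (closestPoint M w))
      (fderiv ℝ (fderiv ℝ (closestPoint M)) q ∘L fderiv ℝ (closestPoint M) q) q := by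
    refine HasFDerivAt.comp q (g := fderiv ℝ (closestPoint M)) ?_ (h.hasFDerivAt hq)
    rw [hfix]
    exact h.hasFDerivAt_fderiv hq
  have hplanes_v := hplanes.clm_apply (hasFDerivAt_const v q)
  have hidem : (fun w => fderiv ℝ (closestPoint M) (closestPoint M w)
      (fderiv ℝ (closestPoint M) (closestPoint M w) v)) =ᶠ[𝓝 q]
      fun w => fderiv ℝ (closestPoint M) (closestPoint M w) v := by
    filter_upwards [h.eventually_closestPoint_mem hq (hfix.symm ▸ hq)] with w ⟨hw, hpw⟩
    rw [h.fderiv_closestPoint_eq_starProjection hw hpw]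
    exact Submodule.starProjection_eq_self_iff.mpr (Submodule.starProjection_apply_mem _ _)
  have heq := DFunLike.congr_fun
    ((hplanes.clm_apply hplanes_v).unique (hplanes_v.congr_of_eventuallyEq hidem)) u
  simpa [hfix, h.fderiv_eq_starProjection hqM hq, add_comm,
    Submodule.starProjection_eq_self_iff.mpr hu] using heq

theorem starProjection_fderiv_fderiv_eq_zero (h : HasSmoothProjection M U) (hqM : q ∈ M)
    (hq : q ∈ U) {u v : E} (hu : u ∈ tangentPlane M q) (hv : v ∈ tangentPlane M q) :
    (tangentPlane M q).starProjection (fderiv ℝ (fderiv ℝ (closestPoint M)) q u v) = 0 := by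
  have hsum := h.fderiv_fderiv_add_starProjection hqM hq hu v
  rwa [Submodule.starProjection_eq_self_iff.mpr hv, add_eq_left] at hsum

theorem fderiv_fderiv_mem_tangentPlane (h : HasSmoothProjection M U) (hqM : q ∈ M)
    (hq : q ∈ U) {u ν : E} (hu : u ∈ tangentPlane M q) (hν : ν ∈ (tangentPlane M q)ᗮ) :
    fderiv ℝ (fderiv ℝ (closestPoint M)) q u ν ∈ tangentPlane M q := by
  have hsum := h.fderiv_fderiv_add_starProjection hqM hq hu ν
  rw [(Submodule.starProjection_apply_eq_zero_iff _).mpr hν, map_zero, zero_add] at hsum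
  exact Submodule.starProjection_eq_self_iff.mp hsum

theorem secondFundamentalForm_eq (h : HasSmoothProjection M U) (hqM : q ∈ M) (hq : q ∈ U)
    {u v : E} (hu : u ∈ tangentPlane M q) (hv : v ∈ tangentPlane M q) :
    secondFundamentalForm M q u v = fderiv ℝ (fderiv ℝ (closestPoint M)) q u v := by
  set D := (fderiv ℝ (fderiv ℝ (closestPoint M)) q).flip v
  have hfield : (fun w => (tangentPlane M w).starProjection v) =ᶠ[𝓝[M] q]
      fun w => fderiv ℝ (closestPoint M) w v := by
    filter_upwards [self_mem_nhdsWithin,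
      eventually_nhdsWithin_of_eventually_nhds (h.isOpen.eventually_mem hq)] with w hwM hw
    rw [h.fderiv_eq_starProjection hwM hw]
  have hD : HasFDerivWithinAt (fun w => (tangentPlane M w).starProjection v) D M q :=
    (h.hasFDerivAt_fderiv_apply hq v).hasFDerivWithinAt.congr_of_eventuallyEq hfield
      (hfield.self_of_nhdsWithin hqM)
  have hcone : tangentConeAt ℝ M q ⊆ LinearMap.eqLocus (fderivWithin ℝ
      (fun w => (tangentPlane M w).starProjection v) M q : E →ₗ[ℝ] E) (D : E →ₗ[ℝ] E) :=
    hD.differentiableWithinAt.hasFDerivWithinAt.unique_on hD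
  have hu' : fderivWithin ℝ (fun w => (tangentPlane M w).starProjection v) M q u = D u :=
    Submodule.span_le.mpr hcone hu
  have hnormal : D u ∈ (tangentPlane M q)ᗮ := (Submodule.starProjection_apply_eq_zero_iff _).mp
    (h.starProjection_fderiv_fderiv_eq_zero hqM hq hu hv)
  rw [secondFundamentalForm, hu', Submodule.starProjection_eq_self_iff.mpr hnormal]
  rfl

end HasSmoothProjection

/-- The shape operator `⟨II(·, ·), z - p(z)⟩` of `M` at `p(z)` in the normal direction `z - p(z)`,
extended by zero to the normal space. -/
def shapeOperator {E : Type*} [NormedAddCommGroup E] [InnerProductSpace ℝ E]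
    [FiniteDimensional ℝ E] (M : Set E) (z : E) : E →L[ℝ] E :=
  (fderiv ℝ (fderiv ℝ (closestPoint M)) (closestPoint M z)).flip (z - closestPoint M z) ∘L
    (tangentPlane M (closestPoint M z)).starProjection

namespace HasSmoothProjection

variable {E : Type*} [NormedAddCommGroup E] [InnerProductSpace ℝ E] [FiniteDimensional ℝ E]
  {M U : Set E} {z : E}

theorem shapeOperator_apply_mem (h : HasSmoothProjection M U) (hz : z ∈ U)
    (hpz : closestPoint M z ∈ U) (v : E) :
    shapeOperator M z v ∈ tangentPlane M (closestPoint M z) :=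
  h.fderiv_fderiv_mem_tangentPlane (h.closestPoint_mem hz) hpz
    (Submodule.starProjection_apply_mem _ v) (h.sub_closestPoint_mem_orthogonal hz hpz)

theorem inner_shapeOperator (h : HasSmoothProjection M U) (hz : z ∈ U)
    (hpz : closestPoint M z ∈ U) {u v : E} (hu : u ∈ tangentPlane M (closestPoint M z))
    (hv : v ∈ tangentPlane M (closestPoint M z)) : inner ℝ (shapeOperator M z u) v =
      inner ℝ (z - closestPoint M z) (secondFundamentalForm M (closestPoint M z) u v) := by
  rw [h.secondFundamentalForm_eq (h.closestPoint_mem hz) hpz hu hv,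
    ← h.inner_fderiv_fderiv_comm hpz]
  simp only [shapeOperator, ContinuousLinearMap.comp_apply, ContinuousLinearMap.flip_apply,
    Submodule.starProjection_eq_self_iff.mpr hu]

theorem isSymmetric_shapeOperator (h : HasSmoothProjection M U) (hz : z ∈ U)
    (hpz : closestPoint M z ∈ U) : (shapeOperator M z : E →ₗ[ℝ] E).IsSymmetric := by
  intro u v
  set S := tangentPlane M (closestPoint M z)
  set P := S.starProjection
  set D := fderiv ℝ (fderiv ℝ (closestPoint M)) (closestPoint M z)
  have hform (a b : E) : inner ℝ (shapeOperator M z a) b =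
      inner ℝ (z - closestPoint M z) (D (P a) (P b)) := calc
    inner ℝ (shapeOperator M z a) b = inner ℝ (P (shapeOperator M z a)) b := by
      rw [Submodule.starProjection_eq_self_iff.mpr (h.shapeOperator_apply_mem hz hpz a)]
    _ = inner ℝ (shapeOperator M z a) (P b) := S.inner_starProjection_left_eq_right _ _
    _ = _ := h.inner_fderiv_fderiv_comm hpz _ _ _
  calc inner ℝ (shapeOperator M z u) v
      = inner ℝ (z - closestPoint M z) (D (P v) (P u)) := by
        rw [hform, h.fderiv_fderiv_comm hpz]
    _ = inner ℝ u (shapeOperator M z v) := by rw [← hform, real_inner_comm]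

theorem fderiv_eq_starProjection_add (h : HasSmoothProjection M U) (hz : z ∈ U)
    (hpz : closestPoint M z ∈ U) : fderiv ℝ (closestPoint M) z =
      (tangentPlane M (closestPoint M z)).starProjection
        + shapeOperator M z * fderiv ℝ (closestPoint M) z := by
  set q := closestPoint M z
  set L := fderiv ℝ (closestPoint M) z
  have hplanes : HasFDerivAt (fun w => fderiv ℝ (closestPoint M) (closestPoint M w))
      (fderiv ℝ (fderiv ℝ (closestPoint M)) q ∘L L) z :=
    HasFDerivAt.comp z (g := fderiv ℝ (closestPoint M)) (h.hasFDerivAt_fderiv hpz)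
      (h.hasFDerivAt hz)
  have hnormal : (fun w => fderiv ℝ (closestPoint M) (closestPoint M w) (w - closestPoint M w))
      =ᶠ[𝓝 z] fun _ => 0 := by
    filter_upwards [h.eventually_closestPoint_mem hz hpz] with w ⟨hw, hpw⟩
    rw [h.fderiv_closestPoint_eq_starProjection hw hpw]
    exact (Submodule.starProjection_apply_eq_zero_iff _).mpr
      (h.sub_closestPoint_mem_orthogonal hw hpw)
  have hzero := (hplanes.clm_apply ((hasFDerivAt_id z).sub (h.hasFDerivAt hz))).unique
    ((hasFDerivAt_const (0 : E) z).congr_of_eventuallyEq hnormal)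
  ext v
  have hLv : (tangentPlane M q).starProjection (L v) = L v :=
    Submodule.starProjection_eq_self_iff.mpr (h.fderiv_apply_mem_tangentPlane hz v)
  have hv : fderiv ℝ (fderiv ℝ (closestPoint M)) q (L v) (z - q)
      + (tangentPlane M q).starProjection (v - L v) = 0 := by
    simpa [h.fderiv_closestPoint_eq_starProjection hz hpz, add_comm] using
      DFunLike.congr_fun hzero v
  rw [map_sub (tangentPlane M q).starProjection, hLv] at hv
  change L v = (tangentPlane M q).starProjection v + fderiv ℝ (fderiv ℝ (closestPoint M)) q
    ((tangentPlane M q).starProjection (L v)) (z - q)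
  rw [hLv, ← sub_eq_zero, ← neg_eq_zero, ← hv]
  abel

theorem clmTrace_shapeOperator (h : HasSmoothProjection M U) (hz : z ∈ U)
    (hpz : closestPoint M z ∈ U) : clmTrace E (shapeOperator M z) =
      inner ℝ (z - closestPoint M z) (meanCurvature M (closestPoint M z)) := by
  set t := stdOrthonormalBasis ℝ (tangentPlane M (closestPoint M z))
  rw [clmTrace_eq_sum_inner_of_forall_mem (h.shapeOperator_apply_mem hz hpz) t, meanCurvature,
    inner_sum]
  refine Finset.sum_congr rfl fun i _ => ?_
  rw [real_inner_comm, h.inner_shapeOperator hz hpz (t i).2 (t i).2]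

theorem clmTrace_shapeOperator_mul_self_le (h : HasSmoothProjection M U) (hz : z ∈ U)
    (hpz : closestPoint M z ∈ U) : clmTrace E (shapeOperator M z * shapeOperator M z) ≤
      (secondFundamentalFormNorm M (closestPoint M z) * Metric.infDist z M) ^ 2 := by
  set q := closestPoint M z
  set t := stdOrthonormalBasis ℝ (tangentPlane M q)
  have hmem := h.shapeOperator_apply_mem hz hpz
  have hrow (i) : ‖shapeOperator M z (t i)‖ ^ 2 =
      ∑ j, inner ℝ (z - q) (secondFundamentalForm M q (t i) (t j)) ^ 2 := by
    have hsum := t.sum_sq_norm_inner_right ⟨shapeOperator M z (t i), hmem _⟩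
    simp only [Submodule.coe_inner, Submodule.coe_norm, Real.norm_eq_abs, sq_abs] at hsum
    rw [← hsum]
    refine Finset.sum_congr rfl fun j _ => ?_
    rw [real_inner_comm, h.inner_shapeOperator hz hpz (t i).2 (t j).2]
  rw [clmTrace_eq_sum_inner_of_forall_mem (A := shapeOperator M z * shapeOperator M z)
      (fun _ => hmem _) t, mul_pow, secondFundamentalFormNorm,
    Real.sq_sqrt (by positivity), h.infDist_eq hz, Finset.sum_mul]
  refine Finset.sum_le_sum fun i _ => ?_
  calc inner ℝ (t i : E) (shapeOperator M z (shapeOperator M z (t i)))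
      = ‖shapeOperator M z (t i)‖ ^ 2 := by
        rw [← real_inner_self_eq_norm_sq]
        exact (h.isSymmetric_shapeOperator hz hpz _ _).symm
    _ = ∑ j, inner ℝ (z - q) (secondFundamentalForm M q (t i) (t j)) ^ 2 := hrow i
    _ ≤ (∑ j, ‖secondFundamentalForm M q (t i) (t j)‖ ^ 2) * ‖z - q‖ ^ 2 := by
        rw [Finset.sum_mul]
        refine Finset.sum_le_sum fun j _ => ?_
        rw [← mul_pow, mul_comm ‖_‖, ← sq_abs]
        gcongr
        exact abs_real_inner_le_norm _ _

theorem laplacianAlong_infDist_sq_div_two (h : HasSmoothProjection M U) (hz : z ∈ U)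
    (T : Submodule ℝ E) : laplacianAlong T (fun w => Metric.infDist w M ^ 2 / 2) z =
      clmTrace E (T.starProjection * (1 - fderiv ℝ (closestPoint M) z)) := by
  have hgrad : gradient (fun w => Metric.infDist w M ^ 2 / 2) =ᶠ[𝓝 z]
      fun w => w - closestPoint M w := by
    filter_upwards [h.isOpen.eventually_mem hz] with w hw
    exact (h.hasGradientAt_infDist_sq_div_two hw).gradient
  have hhess : fderiv ℝ (gradient fun w => Metric.infDist w M ^ 2 / 2) z =
      1 - fderiv ℝ (closestPoint M) z :=
    hgrad.fderiv_eq.trans ((hasFDerivAt_id z).sub (h.hasFDerivAt hz)).fderiv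
  rw [laplacianAlong, divAlong, hhess]
  rfl

theorem laplacianAlong_infDist_sq_ge (h : HasSmoothProjection M U) (hz : z ∈ U)
    (hpz : closestPoint M z ∈ U) {T : Submodule ℝ E}
    (hT : Module.finrank ℝ T = Module.finrank ℝ (tangentPlane M (closestPoint M z)))
    (hII : secondFundamentalFormNorm M (closestPoint M z) ≤ 1)
    (hd : secondFundamentalFormNorm M (closestPoint M z) * Metric.infDist z M ≤ 1 / 2) :
    planeDistSq T (tangentPlane M (closestPoint M z)) / 4
        - ‖meanCurvature M (closestPoint M z)‖ * Metric.infDist z M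
        - 2 * secondFundamentalFormNorm M (closestPoint M z) * Metric.infDist z M ^ 2 ≤
      laplacianAlong T (fun w => Metric.infDist w M ^ 2 / 2) z := by
  set κ := secondFundamentalFormNorm M (closestPoint M z)
  set d := Metric.infDist z M
  have hκ : 0 ≤ κ := Real.sqrt_nonneg _
  have hd0 : 0 ≤ d := Metric.infDist_nonneg
  have htrace := clmTrace_starProjection_mul_one_sub_ge hT.symm
    (h.isSymmetric_shapeOperator hz hpz) (h.shapeOperator_apply_mem hz hpz)
    (h.fderiv_eq_starProjection_add hz hpz) hd (by positivity)
    (h.clmTrace_shapeOperator_mul_self_le hz hpz)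
  have hmean : clmTrace E (shapeOperator M z) ≤ ‖meanCurvature M (closestPoint M z)‖ * d := by
    rw [h.clmTrace_shapeOperator hz hpz, mul_comm, show d = _ from h.infDist_eq hz]
    exact real_inner_le_norm _ _
  have hsq : (κ * d) ^ 2 ≤ κ * d ^ 2 := by
    rw [mul_pow]
    gcongr
    exact pow_le_of_le_one hκ hII two_ne_zero
  rw [h.laplacianAlong_infDist_sq_div_two hz]
  linarith

end HasSmoothProjection

theorem contDiff_adjoint {X Y : Type*} [NormedAddCommGroup X] [InnerProductSpace ℝ X]
    [CompleteSpace X] [NormedAddCommGroup Y] [InnerProductSpace ℝ Y] [CompleteSpace Y]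
    {k : WithTop ℕ∞} :
    ContDiff ℝ k fun A : X →L[ℝ] Y => ContinuousLinearMap.adjoint A :=
  IsBoundedLinearMap.contDiff
    ⟨⟨map_add ContinuousLinearMap.adjoint, fun c A => by simp⟩, 1, one_pos, fun A => by simp⟩

theorem isInvertible_of_norm_sub_id_lt_one {E : Type*} [NormedAddCommGroup E] [NormedSpace ℝ E]
    [CompleteSpace E] {A : E →L[ℝ] E} (hA : ‖A - .id ℝ E‖ < 1) : A.IsInvertible := by
  have hunit : IsUnit (1 - (1 - A)) :=
    isUnit_one_sub_of_norm_lt_one (by rw [norm_sub_rev]; exact hA)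
  rw [sub_sub_cancel] at hunit
  obtain ⟨u, rfl⟩ := hunit
  exact .of_inverse u.mul_inv u.inv_mul

theorem le_of_sq_add_sq_le {s t c L : ℝ} (ht : 0 ≤ t) (hs : 0 ≤ s) (hL : 0 ≤ L)
    (h : t ^ 2 + s ^ 2 ≤ c ^ 2) (hcs : c ≤ s + L * t) (hc : 0 ≤ c) : t ≤ 2 * L * c := by
  have hsc : s ≤ c := le_of_sq_le_sq (by linarith [sq_nonneg t]) hc
  have hmul : t * t ≤ 2 * L * c * t := calc
    t * t ≤ (c - s) * (c + s) := by linarith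
    _ ≤ L * t * (2 * c) := by gcongr <;> linarith
    _ = 2 * L * c * t := by ring
  obtain rfl | htpos := ht.eq_or_lt
  · positivity
  · exact le_of_mul_le_mul_right hmul htpos

section Graph

variable {X Y : Type*}

/-- The graph of `g` over the ball of radius `2`. -/
def graphOver [Norm X] (g : X → Y) : Set (WithLp 2 (X × Y)) :=
  {z | ‖z.fst‖ < 2 ∧ z.snd = g z.fst}

theorem graphMap_mem_graphOver [Norm X] {g : X → Y} {x : X} (hx : ‖x‖ < 2) :
    graphMap g x ∈ graphOver g :=
  ⟨hx, rfl⟩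

theorem eq_graphMap_of_mem_graphOver [Norm X] {g : X → Y} {q : WithLp 2 (X × Y)}
    (hq : q ∈ graphOver g) : q = graphMap g q.fst :=
  withLp_prod_ext rfl hq.2

variable [NormedAddCommGroup X] [NormedAddCommGroup Y]

/-- The points `(x, y)` with `|x| < 3 / 2` and `|y| < 3 / 2`, a neighbourhood of the unit slab that
contains the closest points of `graphOver g` to it. -/
def largeSlab (X Y : Type*) [NormedAddCommGroup X] [NormedAddCommGroup Y] :
    Set (WithLp 2 (X × Y)) := {z | ‖z.fst‖ < 3 / 2 ∧ ‖z.snd‖ < 3 / 2}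

theorem isOpen_largeSlab : IsOpen (largeSlab X Y) :=
  (isOpen_lt (WithLp.continuous_fst 2 X Y).norm continuous_const).inter
    (isOpen_lt (WithLp.continuous_snd 2 X Y).norm continuous_const)

theorem norm_fst_lt_two_of_mem_largeSlab {z : WithLp 2 (X × Y)} (hz : z ∈ largeSlab X Y) :
    ‖z.fst‖ < 2 :=
  hz.1.trans (by norm_num)

variable [InnerProductSpace ℝ X] [InnerProductSpace ℝ Y]

/-- `g : X → Y` is smooth and small in `C²` on the ball of radius `2`. -/
structure IsSmallGraph (g : X → Y) (δ : ℝ) : Prop where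
  contDiffOn : ContDiffOn ℝ ∞ g (Metric.ball 0 2)
  nonneg : 0 ≤ δ
  le : δ ≤ 1 / 20
  norm_le : ∀ x, ‖x‖ < 2 → ‖g x‖ ≤ 2 * δ
  norm_fderiv_le : ∀ x, ‖x‖ < 2 → ‖fderiv ℝ g x‖ ≤ δ
  norm_fderiv_fderiv_le : ∀ x, ‖x‖ < 2 → ‖fderiv ℝ (fderiv ℝ g) x‖ ≤ δ / 2

namespace IsSmallGraph

variable {g : X → Y} {δ : ℝ}

theorem contDiffAt (hg : IsSmallGraph g δ) {x : X} (hx : ‖x‖ < 2) : ContDiffAt ℝ ∞ g x :=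
  hg.contDiffOn.contDiffAt (Metric.isOpen_ball.mem_nhds (mem_ball_zero_iff.mpr hx))

theorem differentiableAt (hg : IsSmallGraph g δ) {x : X} (hx : ‖x‖ < 2) : DifferentiableAt ℝ g x :=
  (hg.contDiffAt hx).differentiableAt (by simp)

theorem contDiffAt_fderiv (hg : IsSmallGraph g δ) {x : X} (hx : ‖x‖ < 2) :
    ContDiffAt ℝ ∞ (fderiv ℝ g) x :=
  (hg.contDiffAt hx).fderiv_right (m := ∞) (by simp)

theorem norm_sub_le (hg : IsSmallGraph g δ) {x y : X} (hx : ‖x‖ < 2) (hy : ‖y‖ < 2) :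
    ‖g x - g y‖ ≤ δ * ‖x - y‖ :=
  (convex_ball (0 : X) 2).norm_image_sub_le_of_norm_fderiv_le
    (fun _ hz => hg.differentiableAt (mem_ball_zero_iff.mp hz))
    (fun z hz => hg.norm_fderiv_le z (mem_ball_zero_iff.mp hz))
    (mem_ball_zero_iff.mpr hy) (mem_ball_zero_iff.mpr hx)

theorem norm_fderiv_sub_le (hg : IsSmallGraph g δ) {x y : X} (hx : ‖x‖ < 2) (hy : ‖y‖ < 2) :
    ‖fderiv ℝ g x - fderiv ℝ g y‖ ≤ δ / 2 * ‖x - y‖ :=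
  (convex_ball (0 : X) 2).norm_image_sub_le_of_norm_fderiv_le
    (fun _ hz => (hg.contDiffAt_fderiv (mem_ball_zero_iff.mp hz)).differentiableAt (by simp))
    (fun z hz => hg.norm_fderiv_fderiv_le z (mem_ball_zero_iff.mp hz))
    (mem_ball_zero_iff.mpr hy) (mem_ball_zero_iff.mpr hx)

end IsSmallGraph

variable [CompleteSpace X] [CompleteSpace Y]

/-- `(x, ν) ↦ (x, g x) + (-Dg(x)ᵀ ν, ν)`: the normal bundle of the graph of `g`, a normal vector
being parametrized by its vertical component `ν`. -/
def normalMap (g : X → Y) (w : WithLp 2 (X × Y)) : WithLp 2 (X × Y) :=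
  w + WithLp.toLp 2 (-(ContinuousLinearMap.adjoint (fderiv ℝ g w.fst) w.snd), g w.fst)

namespace IsSmallGraph

variable {g : X → Y} {δ : ℝ}

theorem norm_adjoint_fderiv_sub_le (hg : IsSmallGraph g δ) {w w' : WithLp 2 (X × Y)}
    (h₁ : ‖w.fst‖ < 2) (h₂ : ‖w.snd‖ < 2) (h₁' : ‖w'.fst‖ < 2) :
    ‖ContinuousLinearMap.adjoint (fderiv ℝ g w.fst) w.snd
      - ContinuousLinearMap.adjoint (fderiv ℝ g w'.fst) w'.snd‖ ≤ 2 * δ * ‖w - w'‖ := by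
  set A := ContinuousLinearMap.adjoint (fderiv ℝ g w.fst)
  set A' := ContinuousLinearMap.adjoint (fderiv ℝ g w'.fst)
  have hδ := hg.nonneg
  have hAA' : ‖A - A'‖ ≤ δ / 2 * ‖w - w'‖ := calc
    ‖A - A'‖ = ‖fderiv ℝ g w.fst - fderiv ℝ g w'.fst‖ := by
      rw [← map_sub, LinearIsometryEquiv.norm_map]
    _ ≤ δ / 2 * ‖w.fst - w'.fst‖ := hg.norm_fderiv_sub_le h₁ h₁'
    _ ≤ δ / 2 * ‖w - w'‖ := by gcongr; exact WithLp.norm_fst_le _ (w - w')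
  have hA' : ‖A'‖ ≤ δ := (LinearIsometryEquiv.norm_map _ _).trans_le (hg.norm_fderiv_le _ h₁')
  calc ‖A w.snd - A' w'.snd‖ = ‖(A - A') w.snd + A' (w.snd - w'.snd)‖ := by simp
    _ ≤ ‖A - A'‖ * ‖w.snd‖ + ‖A'‖ * ‖w.snd - w'.snd‖ :=
      (norm_add_le _ _).trans (add_le_add ((A - A').le_opNorm _) (A'.le_opNorm _))
    _ ≤ δ / 2 * ‖w - w'‖ * 2 + δ * ‖w - w'‖ := by
      gcongr
      exact WithLp.norm_snd_le _ (w - w')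
    _ = 2 * δ * ‖w - w'‖ := by ring

theorem norm_normalMap_sub_le (hg : IsSmallGraph g δ) {w w' : WithLp 2 (X × Y)}
    (h₁ : ‖w.fst‖ < 2) (h₂ : ‖w.snd‖ < 2) (h₁' : ‖w'.fst‖ < 2) :
    ‖(normalMap g w - w) - (normalMap g w' - w')‖ ≤ 3 * δ * ‖w - w'‖ := by
  simp only [normalMap, add_sub_cancel_left]
  refine (norm_le_norm_fst_add_norm_snd _).trans ?_
  have hfst := hg.norm_adjoint_fderiv_sub_le h₁ h₂ h₁'
  have hsnd : ‖g w.fst - g w'.fst‖ ≤ δ * ‖w - w'‖ :=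
    (hg.norm_sub_le h₁ h₁').trans
      (mul_le_mul_of_nonneg_left (WithLp.norm_fst_le _ (w - w')) hg.nonneg)
  simp only [WithLp.sub_fst, WithLp.sub_snd, WithLp.toLp_fst, WithLp.toLp_snd, neg_sub_neg]
  rw [norm_sub_rev]
  linarith

theorem norm_sub_le_two_mul (hg : IsSmallGraph g δ) {w w' : WithLp 2 (X × Y)}
    (h₁ : ‖w.fst‖ < 2) (h₂ : ‖w.snd‖ < 2) (h₁' : ‖w'.fst‖ < 2) :
    ‖w - w'‖ ≤ 2 * ‖normalMap g w - normalMap g w'‖ := by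
  have hcontr := hg.norm_normalMap_sub_le h₁ h₂ h₁'
  rw [sub_sub_sub_comm] at hcontr
  have htri := norm_sub_norm_le (w - w') (normalMap g w - normalMap g w')
  rw [norm_sub_rev (w - w')] at htri
  have hδ : δ * ‖w - w'‖ ≤ 1 / 20 * ‖w - w'‖ := by gcongr; exact hg.le
  linarith [norm_nonneg (w - w')]

theorem contDiffAt_normalMap (hg : IsSmallGraph g δ) {w : WithLp 2 (X × Y)} (h₁ : ‖w.fst‖ < 2) :
    ContDiffAt ℝ ∞ (normalMap g) w := by
  have hfst : ContDiffAt ℝ ∞ (fun w : WithLp 2 (X × Y) => w.fst) w :=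
    (WithLp.fstL 2 ℝ X Y).contDiff.contDiffAt
  have hadj : ContDiffAt ℝ ∞
      (fun w : WithLp 2 (X × Y) => ContinuousLinearMap.adjoint (fderiv ℝ g w.fst)) w :=
    contDiff_adjoint.contDiffAt.comp w (ContDiffAt.comp w (hg.contDiffAt_fderiv h₁) hfst)
  exact contDiffAt_id.add (contDiff_toLp_prod.contDiffAt.comp w
    ((hadj.clm_apply (WithLp.sndL 2 ℝ X Y).contDiff.contDiffAt).neg.prodMk
      (ContDiffAt.comp w (hg.contDiffAt h₁) hfst)))

theorem isInvertible_fderiv_normalMap (hg : IsSmallGraph g δ) {w : WithLp 2 (X × Y)}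
    (h₁ : ‖w.fst‖ < 2) (h₂ : ‖w.snd‖ < 2) : (fderiv ℝ (normalMap g) w).IsInvertible := by
  have hN := ((hg.contDiffAt_normalMap h₁).differentiableAt (by simp)).hasFDerivAt
  have hδ := hg.nonneg
  refine isInvertible_of_norm_sub_id_lt_one (lt_of_le_of_lt (b := 3 * δ) ?_ (by linarith [hg.le]))
  refine (hN.sub (hasFDerivAt_id w)).le_of_lip' (by positivity) ?_
  filter_upwards [(WithLp.continuous_fst 2 X Y).norm.continuousAt.eventually_lt_const h₁,
    (WithLp.continuous_snd 2 X Y).norm.continuousAt.eventually_lt_const h₂] with w' h₁' h₂'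
  exact hg.norm_normalMap_sub_le h₁' h₂' h₁

end IsSmallGraph

end Graph

section ClosestPointGraph

variable {X Y : Type*} [NormedAddCommGroup X] [InnerProductSpace ℝ X]
  [NormedAddCommGroup Y] [InnerProductSpace ℝ Y] {g : X → Y} {δ : ℝ} {z q q' : WithLp 2 (X × Y)}

/-- The coordinates of `z` in the sense of `normalMap` when `q` is the foot of the perpendicular
from `z` to the graph. -/
def normalCoords {X Y : Type*} [AddCommGroup Y] (z q : WithLp 2 (X × Y)) : WithLp 2 (X × Y) :=
  WithLp.toLp 2 (q.fst, z.snd - q.snd)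

namespace IsSmallGraph

theorem norm_snd_sub_lt_two (hg : IsSmallGraph g δ) (hz : z ∈ largeSlab X Y)
    (hq : q ∈ graphOver g) : ‖z.snd - q.snd‖ < 2 := by
  have hgq := hg.norm_le q.fst hq.1
  rw [← hq.2] at hgq
  linarith [_root_.norm_sub_le z.snd q.snd, hz.2, hg.le]

theorem norm_fst_sub_le (hg : IsSmallGraph g δ) (hz : z ∈ largeSlab X Y) (hq : q ∈ graphOver g)
    (h : dist z q ≤ dist z (graphMap g z.fst)) : ‖z.fst - q.fst‖ ≤ 4 * δ := by
  have hz₂ := norm_fst_lt_two_of_mem_largeSlab hz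
  have hvert := hg.norm_snd_sub_lt_two hz (graphMap_mem_graphOver hz₂)
  have hpyth : ‖z.fst - q.fst‖ ^ 2 + ‖z.snd - q.snd‖ ^ 2 ≤ ‖z.snd - g z.fst‖ ^ 2 := by
    have hsq := pow_le_pow_left₀ dist_nonneg h 2
    simpa [dist_eq_norm, WithLp.prod_norm_sq_eq_of_L2] using hsq
  have hlip : ‖z.snd - g z.fst‖ ≤ ‖z.snd - q.snd‖ + δ * ‖z.fst - q.fst‖ := by
    have htri := norm_sub_le_norm_sub_add_norm_sub z.snd q.snd (g z.fst)
    have := hg.norm_sub_le hq.1 hz₂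
    rw [← hq.2, norm_sub_rev q.fst] at this
    linarith
  calc ‖z.fst - q.fst‖ ≤ 2 * δ * ‖z.snd - g z.fst‖ :=
      le_of_sq_add_sq_le (norm_nonneg _) (norm_nonneg _) hg.nonneg hpyth hlip (norm_nonneg _)
    _ ≤ 2 * δ * 2 := by
      have := hg.nonneg
      gcongr
      exact hvert.le
    _ = 4 * δ := by ring

theorem norm_fst_sub_le_of_isClosestPoint (hg : IsSmallGraph g δ) (hz : z ∈ largeSlab X Y)
    (hq : IsClosestPoint (graphOver g) z q) : ‖z.fst - q.fst‖ ≤ 4 * δ :=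
  hg.norm_fst_sub_le hz hq.1
    (hq.dist_le (graphMap_mem_graphOver (norm_fst_lt_two_of_mem_largeSlab hz)))

theorem exists_isClosestPoint [ProperSpace X] (hg : IsSmallGraph g δ) (hz : z ∈ largeSlab X Y) :
    ∃ q, IsClosestPoint (graphOver g) z q := by
  have hball : ∀ x ∈ Metric.closedBall z.fst (1 / 4), ‖x‖ < 2 := fun x hx => by
    have := norm_le_norm_add_norm_sub' x z.fst
    linarith [hz.1, mem_closedBall_iff_norm.mp hx]
  have hcont : ContinuousOn (fun x => dist z (graphMap g x)) (Metric.closedBall z.fst (1 / 4)) :=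
    continuousOn_of_forall_continuousAt fun x hx => continuousAt_const.dist
      (hasFDerivAt_graphMap (hg.differentiableAt (hball x hx))).continuousAt
  have hcenter : z.fst ∈ Metric.closedBall z.fst (1 / 4) :=
    Metric.mem_closedBall_self (by norm_num)
  obtain ⟨x, hx, hmin⟩ := (isCompact_closedBall z.fst (1 / 4)).exists_isMinOn ⟨_, hcenter⟩ hcont
  refine ⟨graphMap g x,
    isClosestPoint_iff.mpr ⟨graphMap_mem_graphOver (hball x hx), fun w hw => ?_⟩⟩
  by_contra! hlt
  have hnear := hg.norm_fst_sub_le hz hw (hlt.le.trans (hmin hcenter))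
  rw [norm_sub_rev] at hnear
  have hle : dist z (graphMap g x) ≤ dist z (graphMap g w.fst) :=
    hmin (mem_closedBall_iff_norm.mpr (by linarith [hg.le]))
  rw [← eq_graphMap_of_mem_graphOver hw] at hle
  exact hle.not_gt hlt

theorem inner_sub_graphDeriv_eq_zero (hg : IsSmallGraph g δ)
    (hq : IsClosestPoint (graphOver g) z q) (a : X) :
    inner ℝ (z - q) (graphDeriv g q.fst a) = 0 := by
  have hqx : graphMap g q.fst = q := (eq_graphMap_of_mem_graphOver hq.1).symm
  have hmin : IsLocalMin (fun y => ‖z - graphMap g y‖ ^ 2 / 2) q.fst := by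
    filter_upwards [continuous_norm.continuousAt.eventually_lt_const hq.1.1] with y hy
    have := hq.dist_le (graphMap_mem_graphOver hy)
    rw [dist_eq_norm, dist_eq_norm] at this
    rw [hqx]
    gcongr
  have hderiv := hasFDerivAt_norm_sq_div_two
    ((hasFDerivAt_graphMap (hg.differentiableAt hq.1.1)).const_sub z)
  have hzero := DFunLike.congr_fun (hmin.hasFDerivAt_eq_zero hderiv) a
  simpa only [hqx, ContinuousLinearMap.comp_apply, neg_apply, innerSL_apply_apply,
    inner_neg_right, zero_apply, neg_eq_zero] using hzero

variable [CompleteSpace X] [CompleteSpace Y]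

theorem normalMap_normalCoords (hg : IsSmallGraph g δ) (hq : IsClosestPoint (graphOver g) z q) :
    normalMap g (normalCoords z q) = z := by
  refine withLp_prod_ext (ext_inner_left ℝ fun a => ?_) ?_
  · have horth := hg.inner_sub_graphDeriv_eq_zero hq a
    rw [WithLp.prod_inner_apply] at horth
    change inner ℝ (z.fst - q.fst) a + inner ℝ (z.snd - q.snd) (fderiv ℝ g q.fst a) = 0 at horth
    change inner ℝ a (q.fst + -ContinuousLinearMap.adjoint (fderiv ℝ g q.fst) (z.snd - q.snd)) = _
    rw [inner_add_right, inner_neg_right, ContinuousLinearMap.adjoint_inner_right,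
      real_inner_comm (z.snd - q.snd)]
    rw [inner_sub_left, real_inner_comm a z.fst, real_inner_comm a q.fst] at horth
    linarith
  · change z.snd - q.snd + g q.fst = z.snd
    rw [hq.1.2, sub_add_cancel]

theorem norm_normalCoords_sub_le (hg : IsSmallGraph g δ) {z' : WithLp 2 (X × Y)}
    (hz : z ∈ largeSlab X Y) (hq : IsClosestPoint (graphOver g) z q)
    (hq' : IsClosestPoint (graphOver g) z' q') :
    ‖normalCoords z q - normalCoords z' q'‖ ≤ 2 * ‖z - z'‖ := by
  have := hg.norm_sub_le_two_mul (w := normalCoords z q) (w' := normalCoords z' q') hq.1.1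
    (hg.norm_snd_sub_lt_two hz hq.1) hq'.1.1
  rwa [hg.normalMap_normalCoords hq, hg.normalMap_normalCoords hq'] at this

theorem isClosestPoint_unique (hg : IsSmallGraph g δ) (hz : z ∈ largeSlab X Y)
    (hq : IsClosestPoint (graphOver g) z q) (hq' : IsClosestPoint (graphOver g) z q') :
    q = q' := by
  have hle := hg.norm_normalCoords_sub_le hz hq hq'
  rw [sub_self, norm_zero, mul_zero] at hle
  have hcoords : normalCoords z q = normalCoords z q' := sub_eq_zero.mp (norm_le_zero_iff.mp hle)
  have hfst : q.fst = q'.fst := congrArg (fun w => w.fst) hcoords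
  exact withLp_prod_ext hfst (by rw [hq.1.2, hq'.1.2, hfst])

theorem contDiffAt_normalCoords (hg : IsSmallGraph g δ)
    (hp : ∀ w ∈ largeSlab X Y, IsClosestPoint (graphOver g) w (closestPoint (graphOver g) w))
    (hz : z ∈ largeSlab X Y) :
    ContDiffAt ℝ ∞ (fun w => normalCoords w (closestPoint (graphOver g) w)) z := by
  set W := fun w => normalCoords w (closestPoint (graphOver g) w)
  have hslab := isOpen_largeSlab.eventually_mem hz
  have hW₁ : ‖(W z).fst‖ < 2 := (hp z hz).1.1
  have hW₂ : ‖(W z).snd‖ < 2 := hg.norm_snd_sub_lt_two hz (hp z hz).1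
  have hsolves (w : WithLp 2 (X × Y)) (hw : w ∈ largeSlab X Y) :
      normalMap g (W w) - w = 0 :=
    sub_eq_zero.mpr (hg.normalMap_normalCoords (hp w hw))
  have hcont : ContinuousAt W z := by
    have hlip : LipschitzOnWith 2 W (largeSlab X Y) := .of_dist_le_mul fun w hw w' hw' => by
      rw [dist_eq_norm, dist_eq_norm]
      exact hg.norm_normalCoords_sub_le hw (hp w hw) (hp w' hw')
    exact hlip.continuousOn.continuousAt hslab
  set F := fun y : WithLp 2 (X × Y) × WithLp 2 (X × Y) => normalMap g y.2 - y.1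
  have hF : ContDiffAt ℝ ∞ F (z, W z) :=
    ((hg.contDiffAt_normalMap hW₁).comp (z, W z) contDiffAt_snd).sub contDiffAt_fst
  refine contDiffAt_of_eventually_apply_eq hF (by simp) ?_ hcont ?_
  · have hpartial : fderiv ℝ F (z, W z) ∘L .inr ℝ _ _ = fderiv ℝ (normalMap g) (W z) := by
      have hN := ((hg.contDiffAt_normalMap hW₁).differentiableAt (by simp)).hasFDerivAt
      exact ((hF.differentiableAt (by simp)).hasFDerivAt.comp (W z)
        (hasFDerivAt_prodMk_right z (W z))).unique (hN.sub_const z)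
    rw [hpartial]
    exact hg.isInvertible_fderiv_normalMap hW₁ hW₂
  · filter_upwards [hslab] with w hw
    exact (hsolves w hw).trans (hsolves z hz).symm

theorem hasSmoothProjection [ProperSpace X] (hg : IsSmallGraph g δ) :
    HasSmoothProjection (graphOver g) (largeSlab X Y) := by
  have hp (z : WithLp 2 (X × Y)) (hz : z ∈ largeSlab X Y) :=
    isClosestPoint_closestPoint (hg.exists_isClosestPoint hz)
  refine ⟨isOpen_largeSlab, hp, fun z hz => ContDiffAt.contDiffWithinAt ?_⟩
  have hfst : ContDiffAt ℝ ∞ (fun w => (closestPoint (graphOver g) w).fst) z :=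
    (WithLp.fstL 2 ℝ X Y).contDiff.comp_contDiffAt
      (f := fun w => normalCoords w (closestPoint (graphOver g) w)) z
      (hg.contDiffAt_normalCoords hp hz)
  refine ((contDiffAt_graphMap (hg.contDiffAt (hp z hz).1.1)).comp z hfst).congr_of_eventuallyEq ?_
  filter_upwards [isOpen_largeSlab.eventually_mem hz] with w hw
  exact eq_graphMap_of_mem_graphOver (hp w hw).1

end IsSmallGraph

end ClosestPointGraph

section GraphCurvature

variable {X Y : Type*} [NormedAddCommGroup X] [InnerProductSpace ℝ X]
  [NormedAddCommGroup Y] [InnerProductSpace ℝ Y]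
  {g : X → Y} {δ : ℝ} {x : X} {z q : WithLp 2 (X × Y)}

namespace IsSmallGraph

theorem infDist_lt_two (hg : IsSmallGraph g δ) (hz : z ∈ largeSlab X Y) :
    Metric.infDist z (graphOver g) < 2 := by
  have hmem := graphMap_mem_graphOver (g := g) (norm_fst_lt_two_of_mem_largeSlab hz)
  have hvert := hg.norm_snd_sub_lt_two hz hmem
  refine ((Metric.infDist_le_dist_of_mem hmem).trans ?_).trans_lt hvert
  rw [dist_eq_norm]
  refine (norm_le_norm_fst_add_norm_snd _).trans ?_
  simp

theorem tangentPlane_eq (hg : IsSmallGraph g δ) (hq : q ∈ graphOver g) :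
    tangentPlane (graphOver g) q = (graphDeriv g q.fst).range := by
  have := tangentPlane_graph hq.1 (hg.differentiableAt hq.1)
  rwa [← eq_graphMap_of_mem_graphOver hq] at this

theorem finrank_tangentPlane (hg : IsSmallGraph g δ) (hq : q ∈ graphOver g) :
    Module.finrank ℝ (tangentPlane (graphOver g) q) = Module.finrank ℝ X := by
  rw [hg.tangentPlane_eq hq, finrank_range_graphDeriv]

theorem hasFDerivAt_graphDeriv_apply (hg : IsSmallGraph g δ) (hx : ‖x‖ < 2) (b : X) :
    HasFDerivAt (fun y => graphDeriv g y b)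
      ((WithLp.prodContinuousLinearEquiv 2 ℝ X Y).symm ∘L
        (ContinuousLinearMap.inr ℝ X Y ∘L (fderiv ℝ (fderiv ℝ g) x).flip b)) x := by
  have hD := ((hg.contDiffAt_fderiv hx).differentiableAt (by simp)).hasFDerivAt
  exact (WithLp.prodContinuousLinearEquiv 2 ℝ X Y).symm.hasFDerivAt.comp x
    ((hasFDerivAt_const b x).prodMk ((ContinuousLinearMap.apply ℝ Y b).hasFDerivAt.comp x hD))

variable [FiniteDimensional ℝ X] [FiniteDimensional ℝ Y]

theorem secondFundamentalForm_graphDeriv (hg : IsSmallGraph g δ) (hx : ‖x‖ < 2)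
    (hq : graphMap g x ∈ largeSlab X Y) (a b : X) :
    secondFundamentalForm (graphOver g) (graphMap g x) (graphDeriv g x a) (graphDeriv g x b) =
      (tangentPlane (graphOver g) (graphMap g x))ᗮ.starProjection
        (WithLp.toLp 2 (0, fderiv ℝ (fderiv ℝ g) x a b)) := by
  have h := hg.hasSmoothProjection
  set p := closestPoint (graphOver g)
  have hmem := graphMap_mem_graphOver (g := g) hx
  have htangent (y : X) (hy : ‖y‖ < 2) (c : X) :
      graphDeriv g y c ∈ tangentPlane (graphOver g) (graphMap g y) := by
    rw [hg.tangentPlane_eq (graphMap_mem_graphOver hy)]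
    exact ⟨c, rfl⟩
  have hgraph := hasFDerivAt_graphMap (hg.differentiableAt hx)
  have hfix : (fun y => graphDeriv g y b) =ᶠ[𝓝 x]
      fun y => (fderiv ℝ p ∘ graphMap g) y (graphDeriv g y b) := by
    filter_upwards [continuous_norm.continuousAt.eventually_lt_const hx,
      hgraph.continuousAt (isOpen_largeSlab.mem_nhds hq)] with y hy hyq
    exact (h.fderiv_apply_of_mem_tangentPlane (graphMap_mem_graphOver hy) hyq
      (htangent y hy b)).symm
  have hderiv := hg.hasFDerivAt_graphDeriv_apply hx b
  -- Differentiate `Dp(γ(y)) γ'(y) b = γ'(y) b`, where `γ = graphMap g`.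
  have hsum := DFunLike.congr_fun (hderiv.unique
    ((((h.hasFDerivAt_fderiv hq).comp x hgraph).clm_apply hderiv).congr_of_eventuallyEq hfix)) a
  rw [h.secondFundamentalForm_eq hmem hq (htangent x hx a) (htangent x hx b),
    Submodule.starProjection_orthogonal, ← h.fderiv_eq_starProjection hmem hq]
  exact eq_sub_of_add_eq' hsum.symm

theorem norm_secondFundamentalForm_le (hg : IsSmallGraph g δ) (hqM : q ∈ graphOver g)
    (hq : q ∈ largeSlab X Y) {u v : WithLp 2 (X × Y)} (hu : u ∈ tangentPlane (graphOver g) q)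
    (hv : v ∈ tangentPlane (graphOver g) q) :
    ‖secondFundamentalForm (graphOver g) q u v‖ ≤ δ / 2 * ‖u‖ * ‖v‖ := by
  rw [hg.tangentPlane_eq hqM] at hu hv
  obtain ⟨a, rfl⟩ := hu
  obtain ⟨b, rfl⟩ := hv
  have hform := hg.secondFundamentalForm_graphDeriv hqM.1
    (by rwa [← eq_graphMap_of_mem_graphOver hqM]) a b
  rw [← eq_graphMap_of_mem_graphOver hqM] at hform
  calc ‖secondFundamentalForm (graphOver g) q (graphDeriv g q.fst a) (graphDeriv g q.fst b)‖
    _ ≤ ‖WithLp.toLp 2 ((0 : X), fderiv ℝ (fderiv ℝ g) q.fst a b)‖ := by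
      rw [hform]
      exact Submodule.norm_starProjection_apply_le _ _
    _ = ‖fderiv ℝ (fderiv ℝ g) q.fst a b‖ := WithLp.norm_toLp_snd 2 X Y _
    _ ≤ ‖fderiv ℝ (fderiv ℝ g) q.fst‖ * ‖a‖ * ‖b‖ := ContinuousLinearMap.le_opNorm₂ _ _ _
    _ ≤ δ / 2 * ‖graphDeriv g q.fst a‖ * ‖graphDeriv g q.fst b‖ := by
      have := hg.nonneg
      gcongr
      · exact hg.norm_fderiv_fderiv_le _ hqM.1
      · exact WithLp.norm_fst_le _ (graphDeriv g q.fst a)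
      · exact WithLp.norm_fst_le _ (graphDeriv g q.fst b)

theorem secondFundamentalFormNorm_le (hg : IsSmallGraph g δ) (hqM : q ∈ graphOver g)
    (hq : q ∈ largeSlab X Y) :
    secondFundamentalFormNorm (graphOver g) q ≤ Module.finrank ℝ X * (δ / 2) := by
  have hδ := hg.nonneg
  refine Real.sqrt_le_iff.mpr ⟨by positivity, ?_⟩
  set e := stdOrthonormalBasis ℝ (tangentPlane (graphOver g) q)
  have hterm : ∀ i j, ‖secondFundamentalForm (graphOver g) q (e i) (e j)‖ ^ 2 ≤ (δ / 2) ^ 2 := by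
    intro i j
    have hle := hg.norm_secondFundamentalForm_le hqM hq (e i).2 (e j).2
    have hnorm (i) : ‖(e i : WithLp 2 (X × Y))‖ = 1 := e.norm_eq_one i
    rw [hnorm, hnorm, mul_one, mul_one] at hle
    gcongr
  calc ∑ i, ∑ j, ‖secondFundamentalForm (graphOver g) q (e i) (e j)‖ ^ 2
    _ ≤ ∑ i : Fin _, ∑ j : Fin _, (δ / 2) ^ 2 :=
      Finset.sum_le_sum fun i _ => Finset.sum_le_sum fun j _ => hterm i j
    _ = (Module.finrank ℝ X * (δ / 2)) ^ 2 := by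
      simp only [Finset.sum_const, Finset.card_univ, Fintype.card_fin, nsmul_eq_mul,
        hg.finrank_tangentPlane hqM]
      ring

theorem closestPoint_mem_largeSlab (hg : IsSmallGraph g δ) (hz : z ∈ largeSlab X Y)
    (hz₁ : ‖z.fst‖ < 1) : closestPoint (graphOver g) z ∈ largeSlab X Y := by
  have hp := hg.hasSmoothProjection.isClosestPoint z hz
  have hδ := hg.le
  refine ⟨?_, ?_⟩
  · have := hg.norm_fst_sub_le_of_isClosestPoint hz hp
    linarith [norm_le_norm_add_norm_sub z.fst (closestPoint (graphOver g) z).fst]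
  · rw [hp.1.2]
    linarith [hg.norm_le _ hp.1.1]

theorem existsUnique_isClosestPoint (hg : IsSmallGraph g δ) (hz : z ∈ largeSlab X Y) :
    ∃! q, IsClosestPoint (graphOver g) z q :=
  ⟨_, hg.hasSmoothProjection.isClosestPoint z hz, fun _ hq =>
    hg.isClosestPoint_unique hz hq (hg.hasSmoothProjection.isClosestPoint z hz)⟩

end IsSmallGraph

end GraphCurvature

theorem IsFlatIn.exists_isSmallGraph {m n : ℕ} {δ : ℝ} {M : Set (Ambient m n)} (hδ : δ ≤ 1 / 20)
    (hM : M ⊆ openCylinder m n 2) (hsmooth : IsSmoothSubmanifold M) (hflat : IsFlatIn δ M 2) :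
    ∃ g : EuclideanSpace ℝ (Fin m) → EuclideanSpace ℝ (Fin n),
      IsSmallGraph g δ ∧ M = graphOver g := by
  obtain ⟨g, hg, hMg, hbound⟩ := hflat
  rw [inter_eq_left.mpr hM] at hMg
  have hbound' (x : EuclideanSpace ℝ (Fin m)) (hx : ‖x‖ < 2) :=
    hbound x (mem_ball_zero_iff.mpr hx)
  refine ⟨g, ⟨?_, ?_, hδ, fun x hx => ?_, fun x hx => ?_, fun x hx => ?_⟩, hMg⟩
  · exact contDiffOn_of_graph_straightened hMg hsmooth (hg.differentiableOn (by simp))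
  · exact le_trans (by positivity) (hbound' 0 (by simp))
  all_goals
    have := norm_nonneg (g x)
    have := norm_nonneg (fderiv ℝ g x)
    have := norm_nonneg (fderiv ℝ (fderiv ℝ g) x)
    linarith [hbound' x hx]

section ApproxTangent

theorem integrable_of_support_subset {α : Type*} [MeasurableSpace α] {μ : Measure α} {f : α → ℝ}
    {s : Set α} {C : ℝ} (hs : μ s < ⊤) (hf : AEStronglyMeasurable f μ) (hC : ∀ w, |f w| ≤ C)
    (hfs : Function.support f ⊆ s) : Integrable f μ :=
  (integrableOn_iff_integrable_of_support_subset hfs).mp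
    (Measure.integrableOn_of_bounded hs.ne hf (.of_forall hC))

theorem integral_le_measureReal {α : Type*} [MeasurableSpace α] {μ : Measure α} {f : α → ℝ}
    {A : Set α} (hA : MeasurableSet A) (hμA : μ A < ⊤) (h₀ : ∀ w, 0 ≤ f w) (h₁ : ∀ w, f w ≤ 1)
    (hfA : Function.support f ⊆ A) :
    ∫ w, f w ∂μ ≤ μ.real A := by
  rw [← integral_indicator_one hA]
  refine integral_mono_of_nonneg (.of_forall h₀)
    ((integrable_indicator_iff hA).mpr (integrableOn_const hμA.ne)) (.of_forall fun w => ?_)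
  by_cases hw : f w = 0
  · rw [hw]
    exact indicator_nonneg (fun _ _ => zero_le_one) w
  · rw [indicator_of_mem (hfA hw)]
    exact h₁ w

theorem eventually_measure_closedBall_lt_top {X : Type*} [PseudoMetricSpace X]
    [MeasurableSpace X] {μ : Measure X} {z : X} (hμ : μ.FiniteAtFilter (𝓝 z)) (R : ℝ) :
    ∀ᶠ r in 𝓝[>] (0 : ℝ), μ (Metric.closedBall z (r * R)) < ⊤ := by
  obtain ⟨s, hs, hμs⟩ := hμ
  obtain ⟨ρ, hρ, hρs⟩ := Metric.nhds_basis_closedBall.mem_iff.mp hs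
  have hlim : Tendsto (fun r : ℝ => r * R) (𝓝[>] 0) (𝓝 0) :=
    ((continuous_mul_const R).tendsto' 0 0 (zero_mul R)).mono_left nhdsWithin_le_nhds
  filter_upwards [hlim.eventually_lt_const hρ] with r hr
  exact (measure_mono ((Metric.closedBall_subset_closedBall hr.le).trans hρs)).trans_lt hμs

variable {E : Type*} [NormedAddCommGroup E] [InnerProductSpace ℝ E] {z v : E} {m : ℕ} {θ r : ℝ}
  {T T' : Submodule ℝ E} {M : Set E}

theorem inv_smul_sub_mem_closedBall_iff (hr : 0 < r) {w : E} {R : ℝ} :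
    r⁻¹ • (w - z) ∈ Metric.closedBall 0 R ↔ w ∈ Metric.closedBall z (r * R) := by
  rw [mem_closedBall_zero_iff, mem_closedBall_iff_norm, norm_smul, norm_inv,
    Real.norm_of_nonneg hr.le, inv_mul_le_iff₀ hr]

theorem eventually_add_smul_notMem [FiniteDimensional ℝ E] (hv : v ∉ T')
    (hM : (fun w => T'ᗮ.starProjection (w - z)) =o[𝓝[M] z] fun w => w - z) :
    ∃ ε > 0, ∀ᶠ r in 𝓝[>] (0 : ℝ), ∀ u ∈ Metric.ball v ε, z + r • u ∉ M := by
  set N := T'ᗮ.starProjection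
  have hN (u : E) : ‖N u‖ ≤ ‖u‖ := Submodule.norm_starProjection_apply_le _ u
  have hNv : 0 < ‖N v‖ := norm_pos_iff.mpr fun h0 => hv (by
    rwa [Submodule.starProjection_apply_eq_zero_iff, Submodule.orthogonal_orthogonal] at h0)
  set ε := ‖N v‖ / 2 with hε
  set R := ‖v‖ + ε
  have hR : 0 < R := by positivity
  obtain ⟨ρ, hρ, hnear⟩ := Metric.eventually_nhds_iff.mp
    (eventually_nhdsWithin_iff.mp (hM.def (c := ε / R) (by positivity)))
  refine ⟨ε, by positivity, ?_⟩
  filter_upwards [Ioo_mem_nhdsGT (show 0 < ρ / R by positivity)] with r hr u hu hmem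
  rw [mem_ball_iff_norm] at hu
  have huR : ‖u‖ < R := by linarith [norm_sub_norm_le u v]
  have hdist : dist (z + r • u) z < ρ := by
    rw [dist_eq_norm, add_sub_cancel_left, norm_smul, Real.norm_of_nonneg hr.1.le]
    calc r * ‖u‖ ≤ r * R := by
          have := hr.1
          gcongr
      _ < ρ := (lt_div_iff₀ hR).mp hr.2
  have hNu : ‖N u‖ ≤ ε / R * ‖u‖ := by
    have hle := hnear hdist hmem
    rw [add_sub_cancel_left, map_smul, norm_smul, norm_smul, mul_left_comm] at hle
    exact le_of_mul_le_mul_left hle (norm_pos_iff.mpr hr.1.ne')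
  have hsmall : ε / R * ‖u‖ ≤ ε := calc
    ε / R * ‖u‖ ≤ ε / R * R := by gcongr
    _ = ε := div_mul_cancel₀ _ hR.ne'
  have htri : ‖N v‖ ≤ ‖N u‖ + ‖u - v‖ := by
    have := norm_sub_norm_le (N v) (N u)
    rw [← map_sub] at this
    linarith [hN (v - u), norm_sub_rev u v]
  linarith [hε]

variable [MeasurableSpace E] [BorelSpace E] {μ : Measure E}

theorem eventually_integrable_comp_inv_smul_sub (hμ : μ.FiniteAtFilter (𝓝 z)) {φ : E → ℝ}
    (hφ : Continuous φ) (hφc : HasCompactSupport φ) :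
    ∀ᶠ r in 𝓝[>] (0 : ℝ), Integrable (fun w => φ (r⁻¹ • (w - z))) μ := by
  obtain ⟨C, hC⟩ := hφc.exists_bound_of_continuous hφ
  obtain ⟨R, hR⟩ := hφc.isCompact.isBounded.subset_closedBall 0
  filter_upwards [eventually_measure_closedBall_lt_top hμ R, self_mem_nhdsWithin] with r hfin hr
  refine integrable_of_support_subset hfin ?_ (fun w => hC _)
    fun w hw => (inv_smul_sub_mem_closedBall_iff hr).mp (hR (subset_tsupport φ hw))
  exact (hφ.comp (by fun_prop)).aestronglyMeasurable

variable [FiniteDimensional ℝ E]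

theorem setIntegral_hausdorff_pos (hT : Module.finrank ℝ T = m) {φ : E → ℝ}
    (hφ : Continuous φ) (hφc : HasCompactSupport φ) (hφ₀ : ∀ w, 0 ≤ φ w) (hv : v ∈ T)
    (hφv : φ v ≠ 0) : 0 < ∫ w in (T : Set E), φ w ∂(hausdorff E m) := by
  have hT_closed : IsClosed (T : Set E) := T.closed_of_finiteDimensional
  have hmap : (μH[(m : ℝ)] : Measure E).restrict (T : Set E) =
      (μH[(m : ℝ)] : Measure T).map Subtype.val := by
    have h := (isometry_subtype_coe (s := (T : Set E))).map_hausdorffMeasure (d := (m : ℝ))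
      (Or.inl (Nat.cast_nonneg m))
    rw [Subtype.range_coe] at h
    exact h.symm
  have hemb : MeasurableEmbedding (Subtype.val : T → E) :=
    MeasurableEmbedding.subtype_coe hT_closed.measurableSet
  rw [hausdorff, Measure.restrict_smul, integral_smul_measure, hmap, hemb.integral_map]
  refine smul_pos (ENNReal.toReal_pos (Metric.measure_ball_pos _ _ (by norm_num)).ne'
    measure_ball_lt_top.ne) ?_
  subst hT
  exact (hφ.comp continuous_subtype_val).integral_pos_of_hasCompactSupport_nonneg_nonzero
    (hφc.comp_isClosedEmbedding hT_closed.isClosedEmbedding_subtypeVal) (fun t => hφ₀ t)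
    (x := (⟨v, hv⟩ : T)) hφv

namespace IsApproxTangent

theorem exists_measureReal_closedBall_le (h : IsApproxTangent m μ θ z T)
    (hμ : μ.FiniteAtFilter (𝓝 z)) :
    ∃ C, ∀ᶠ r in 𝓝[>] (0 : ℝ), μ.real (Metric.closedBall z r) ≤ C * r ^ m := by
  let ψ : ContDiffBump (0 : E) := ⟨1, 2, one_pos, one_lt_two⟩
  have hlim := h ψ ψ.continuous ψ.hasCompactSupport
  set ℓ := θ * ∫ w in (T : Set E), ψ w ∂(hausdorff E m)
  refine ⟨ℓ + 1, ?_⟩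
  filter_upwards [hlim.eventually_lt_const (lt_add_one ℓ), self_mem_nhdsWithin,
    eventually_integrable_comp_inv_smul_sub hμ ψ.continuous ψ.hasCompactSupport]
    with r hlt (hr : 0 < r) hint
  have hball : Metric.closedBall z r ⊆ {w | 1 ≤ ψ (r⁻¹ • (w - z))} := fun w hw =>
    (ψ.one_of_mem_closedBall ((inv_smul_sub_mem_closedBall_iff hr).mpr (by rwa [mul_one]))).ge
  calc μ.real (Metric.closedBall z r)
    _ ≤ μ.real {w | 1 ≤ ψ (r⁻¹ • (w - z))} :=
      measureReal_mono hball (hint.measure_ge_lt_top one_pos).ne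
    _ ≤ ∫ w, ψ (r⁻¹ • (w - z)) ∂μ := by
      simpa using mul_meas_ge_le_integral_of_nonneg (.of_forall fun w => ψ.nonneg) hint 1
    _ ≤ (ℓ + 1) * r ^ m := by
      rw [mul_comm]
      exact ((inv_mul_lt_iff₀ (by positivity)).mp hlt).le

theorem tendsto_measureReal_inter_closedBall (h : IsApproxTangent m μ θ z T)
    (hμ : μ.FiniteAtFilter (𝓝 z)) {s : Set E}
    (hs : Tendsto (fun r => μ (s ∩ Metric.closedBall z r) / μ (Metric.closedBall z r))
      (𝓝[>] 0) (𝓝 0)) :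
    Tendsto (fun r => (r ^ m)⁻¹ * μ.real (s ∩ Metric.closedBall z r)) (𝓝[>] 0) (𝓝 0) := by
  obtain ⟨C, hC⟩ := h.exists_measureReal_closedBall_le hμ
  set ratio : ℝ → ℝ := fun r =>
    (μ (s ∩ Metric.closedBall z r) / μ (Metric.closedBall z r)).toReal
  have hratio : Tendsto (fun r => C * ratio r) (𝓝[>] 0) (𝓝 0) := by
    have := ((ENNReal.tendsto_toReal ENNReal.zero_ne_top).comp hs).const_mul C
    rwa [ENNReal.toReal_zero, mul_zero] at this
  refine squeeze_zero' ?_ ?_ hratio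
  · filter_upwards [self_mem_nhdsWithin] with r (hr : 0 < r)
    positivity
  filter_upwards [hC, self_mem_nhdsWithin, eventually_measure_closedBall_lt_top hμ 1]
    with r hle (hr : 0 < r) hfin
  rw [mul_one] at hfin
  have hmul : μ.real (s ∩ Metric.closedBall z r) = ratio r * μ.real (Metric.closedBall z r) := by
    have hmono : μ.real (s ∩ Metric.closedBall z r) ≤ μ.real (Metric.closedBall z r) :=
      measureReal_mono inter_subset_right hfin.ne
    simp only [ratio, ENNReal.toReal_div]
    refine (div_mul_cancel_of_imp fun h0 => ?_).symm
    exact le_antisymm (hmono.trans_eq h0) measureReal_nonneg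
  rw [inv_mul_le_iff₀ (by positivity), hmul]
  calc ratio r * μ.real (Metric.closedBall z r) ≤ ratio r * (C * r ^ m) := by
        gcongr
    _ = r ^ m * (C * ratio r) := by ring

theorem le_of_tendsto_density (h : IsApproxTangent m μ θ z T) (hθ : 0 < θ)
    (hT : Module.finrank ℝ T = m) (hμ : μ.FiniteAtFilter (𝓝 z)) (hM : MeasurableSet M)
    (hdens : Tendsto (fun r => μ (Mᶜ ∩ Metric.closedBall z r) / μ (Metric.closedBall z r))
      (𝓝[>] 0) (𝓝 0))
    (hdiff : (fun w => T'ᗮ.starProjection (w - z)) =o[𝓝[M] z] fun w => w - z) : T ≤ T' := by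
  suffices hunit : ∀ v ∈ T, ‖v‖ < 1 → v ∈ T' by
    intro v hv
    have hpos : 0 < 1 + ‖v‖ := by positivity
    rw [← T'.smul_mem_iff (inv_ne_zero hpos.ne')]
    refine hunit _ (T.smul_mem _ hv) ?_
    rw [norm_smul, norm_inv, Real.norm_of_nonneg hpos.le, inv_mul_lt_iff₀ hpos]
    linarith
  intro v hv hv₁
  by_contra hvT'
  obtain ⟨ε, hε, hoff⟩ := eventually_add_smul_notMem hvT' hdiff
  have hrOut : 0 < min ε (1 - ‖v‖) := lt_min hε (by linarith)
  let φ : ContDiffBump v := ⟨_, _, half_pos hrOut, half_lt_self hrOut⟩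
  have hpos : 0 < θ * ∫ w in (T : Set E), φ w ∂(hausdorff E m) :=
    mul_pos hθ (setIntegral_hausdorff_pos hT φ.continuous φ.hasCompactSupport (fun _ => φ.nonneg)
      hv (φ.pos_of_mem_ball (Metric.mem_ball_self hrOut)).ne')
  have hlim := h φ φ.continuous φ.hasCompactSupport
  refine hpos.not_ge (le_of_tendsto_of_tendsto hlim
    (h.tendsto_measureReal_inter_closedBall hμ hdens) ?_)
  filter_upwards [hoff, self_mem_nhdsWithin, eventually_measure_closedBall_lt_top hμ 1]
    with r hoff (hr : 0 < r) hfin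
  rw [mul_one] at hfin
  gcongr
  refine integral_le_measureReal (hM.compl.inter Metric.isClosed_closedBall.measurableSet)
    ((measure_mono inter_subset_right).trans_lt hfin) (fun _ => φ.nonneg) (fun _ => φ.le_one)
    fun w hw => ?_
  have hball : r⁻¹ • (w - z) ∈ Metric.ball v (min ε (1 - ‖v‖)) := by
    rw [← φ.support_eq]
    exact hw
  refine ⟨fun hwM => hoff _ (Metric.ball_subset_ball (min_le_left _ _) hball) ?_, ?_⟩
  · rwa [smul_inv_smul₀ hr.ne', add_sub_cancel]
  · rw [← mul_one r, ← inv_smul_sub_mem_closedBall_iff hr, mem_closedBall_zero_iff]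
    have hlt := (mem_ball_iff_norm.mp hball).trans_le (min_le_right _ _)
    linarith [norm_sub_norm_le (r⁻¹ • (w - z)) v]

end IsApproxTangent

theorem ae_tendsto_measure_compl_inter_div {U : Set E}
    (hμ : ∀ z ∈ U, μ.FiniteAtFilter (𝓝 z)) (hM : MeasurableSet M) :
    ∀ᵐ z ∂μ, z ∈ U → z ∈ M →
      Tendsto (fun r => μ (Mᶜ ∩ Metric.closedBall z r) / μ (Metric.closedBall z r))
        (𝓝[>] 0) (𝓝 0) := by
  refine measure_null_of_locally_null _ fun x hx => ?_
  obtain ⟨hxU, -⟩ := Classical.not_imp.mp hx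
  obtain ⟨s, hs, hμs⟩ := hμ x hxU
  obtain ⟨W, hWs, hW, hxW⟩ := mem_nhds_iff.mp hs
  have : IsFiniteMeasure (μ.restrict W) :=
    ⟨by rw [Measure.restrict_apply_univ]; exact (measure_mono hWs).trans_lt hμs⟩
  have hBes := Besicovitch.ae_tendsto_measure_inter_div_of_measurableSet (μ.restrict W) hM.compl
  rw [ae_restrict_iff' hW.measurableSet] at hBes
  refine ⟨_, inter_mem_nhdsWithin _ (hW.mem_nhds hxW), measure_mono_null ?_ hBes⟩
  rintro z ⟨hz, hzW⟩ hgood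
  refine hz fun _ hzM => ?_
  have hlim := hgood hzW
  rw [indicator_of_notMem (not_not_intro hzM)] at hlim
  obtain ⟨ρ, hρ, hρW⟩ := Metric.nhds_basis_closedBall.mem_iff.mp (hW.mem_nhds hzW)
  refine hlim.congr' ?_
  filter_upwards [Ioc_mem_nhdsGT hρ] with r hr
  have hrW : Metric.closedBall z r ⊆ W := (Metric.closedBall_subset_closedBall hr.2).trans hρW
  rw [Measure.restrict_apply' hW.measurableSet, Measure.restrict_apply' hW.measurableSet,
    inter_eq_left.mpr (inter_subset_right.trans hrW), inter_eq_left.mpr hrW]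

namespace IntegralVarifold

variable {U : Set E} (V : IntegralVarifold m U)

theorem ae_mem_carrier : ∀ᵐ z ∂V.weight, z ∈ V.carrier :=
  (withDensity_absolutelyContinuous _ _).ae_le (ae_restrict_mem V.measurableSet_carrier)

theorem finiteAt_nhds (hU : IsOpen U) {z : E} (hz : z ∈ U) : V.weight.FiniteAtFilter (𝓝 z) := by
  obtain ⟨K, hK, hKU, hKc⟩ := local_compact_nhds (hU.mem_nhds hz)
  exact ⟨K, hK, V.finite_on_compacts K hKU hKc⟩

theorem ae_mem_supp : ∀ᵐ z ∂V.weight, z ∈ V.supp := by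
  filter_upwards [V.ae_mem_carrier, V.weight.support_mem_ae] with z hz hz'
  exact ⟨V.carrier_subset hz, hz'⟩

theorem ae_tangent_eq (hU : IsOpen U) (hM : MeasurableSet M) {T' : E → Submodule ℝ E}
    (hfin : ∀ z ∈ M, z ∈ U → Module.finrank ℝ (T' z) = m)
    (hdiff : ∀ z ∈ M, z ∈ U →
      (fun w => (T' z)ᗮ.starProjection (w - z)) =o[𝓝[M] z] fun w => w - z) :
    ∀ᵐ z ∂V.weight, z ∈ M → V.tangent z = T' z := by
  filter_upwards [ae_tendsto_measure_compl_inter_div (fun z => V.finiteAt_nhds hU) hM,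
    V.ae_mem_carrier, V.isApproxTangent] with z hdens hcarrier happrox hzM
  have hzU := V.carrier_subset hcarrier
  have hle : V.tangent z ≤ T' z := happrox.le_of_tendsto_density
    (mod_cast V.density_pos z hcarrier) (V.finrank_tangent z) (V.finiteAt_nhds hU hzU) hM
    (hdens hzU hzM) (hdiff z hzM hzU)
  exact Submodule.eq_of_le_of_finrank_eq hle (by rw [V.finrank_tangent, hfin z hzM hzU])

end IntegralVarifold

end ApproxTangent

section DistanceAlong

theorem hasGradientAt_along {E : Type*} [NormedAddCommGroup E] [InnerProductSpace ℝ E]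
    [FiniteDimensional ℝ E] {f : E → ℝ} {ν z : E} (hf : HasGradientAt f ν z)
    (T : Submodule ℝ E) :
    HasGradientAt (fun v : T => f (z + v)) (T.orthogonalProjectionOnto ν) 0 := by
  rw [hasGradientAt_iff_hasFDerivAt] at hf ⊢
  have hf' : HasFDerivAt f (InnerProductSpace.toDual ℝ E ν) (z + ((0 : T) : E)) := by
    rwa [Submodule.coe_zero, add_zero]
  refine (hf'.comp (0 : T) (T.subtypeL.hasFDerivAt.const_add z)).congr_fderiv ?_
  ext v
  exact (T.inner_orthogonalProjectionOnto_eq_of_mem_right v ν).symm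

namespace HasSmoothProjection

theorem measurableSet_inter {E : Type*} [NormedAddCommGroup E] [InnerProductSpace ℝ E]
    [MeasurableSpace E] [BorelSpace E] {M U : Set E} (h : HasSmoothProjection M U) :
    MeasurableSet (M ∩ U) := by
  have hfix : M ∩ U = U \ (U ∩ (fun w => closestPoint M w - w) ⁻¹' {0}ᶜ) := by
    ext w
    refine ⟨fun ⟨hwM, hw⟩ => ⟨hw, fun hne => hne.2 (sub_eq_zero.mpr (closestPoint_eq_self hwM))⟩,
      fun ⟨hw, heq⟩ => ⟨?_, hw⟩⟩
    have hpw : closestPoint M w = w := sub_eq_zero.mp (by_contra fun hne => heq ⟨hw, hne⟩)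
    exact hpw ▸ h.closestPoint_mem hw
  have hopen := (h.contDiffOn.continuousOn.sub continuousOn_id).isOpen_inter_preimage h.isOpen
    (isOpen_compl_singleton (x := (0 : E)))
  rw [hfix]
  exact h.isOpen.measurableSet.diff hopen.measurableSet

variable {E : Type*} [NormedAddCommGroup E] [InnerProductSpace ℝ E] [FiniteDimensional ℝ E]
  {M U : Set E} {z : E}

theorem hasGradientAt_infDist (h : HasSmoothProjection M U) (hz : z ∈ U)
    (hd : Metric.infDist z M ≠ 0) :
    HasGradientAt (fun w => Metric.infDist w M)
      ((Metric.infDist z M)⁻¹ • (z - closestPoint M z)) z := by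
  have hsq := (h.hasGradientAt_infDist_sq_div_two hz).hasFDerivAt
  have hsqrt := (hsq.const_mul 2).sqrt (by positivity)
  have hdist (w : E) : √(2 * (Metric.infDist w M ^ 2 / 2)) = Metric.infDist w M := by
    rw [mul_div_cancel₀ _ two_ne_zero, Real.sqrt_sq Metric.infDist_nonneg]
  simp only [hdist] at hsqrt
  rw [hasGradientAt_iff_hasFDerivAt]
  refine hsqrt.congr_fderiv ?_
  rw [smul_smul, map_smul]
  congr 1
  field_simp

theorem norm_gradientAlong_infDist_sq_le (h : HasSmoothProjection M U) (hz : z ∈ U)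
    (hpz : closestPoint M z ∈ U) (hd : Metric.infDist z M ≠ 0) (T : Submodule ℝ E) :
    DifferentiableAlong T (fun w => Metric.infDist w M) z ∧
      ‖gradientAlong T (fun w => Metric.infDist w M) z‖ ^ 2 ≤
        planeDistSq T (tangentPlane M (closestPoint M z)) := by
  have hgrad := hasGradientAt_along (h.hasGradientAt_infDist hz hd) T
  refine ⟨hgrad.differentiableAt, ?_⟩
  set ν := (Metric.infDist z M)⁻¹ • (z - closestPoint M z)
  have hν : ‖ν‖ = 1 := by
    rw [norm_smul, norm_inv, Real.norm_of_nonneg Metric.infDist_nonneg, ← h.infDist_eq hz,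
      inv_mul_cancel₀ hd]
  have hle := norm_starProjection_sq_le_planeDistSq_mul T
    (Submodule.smul_mem _ (Metric.infDist z M)⁻¹ (h.sub_closestPoint_mem_orthogonal hz hpz))
  rw [hν, one_pow, mul_one] at hle
  rw [gradientAlong, hgrad.gradient]
  exact hle

theorem hasGradientAt_infDist_tangentPlane (h : HasSmoothProjection M U) (hzM : z ∈ M)
    (hz : z ∈ U) :
    HasGradientAt (fun v : tangentPlane M z => Metric.infDist (z + v) M) 0 0 := by
  set T := tangentPlane M z
  have hp : HasFDerivAt (closestPoint M) T.starProjection (z + ((0 : T) : E)) := by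
    rw [Submodule.coe_zero, add_zero, ← h.fderiv_eq_starProjection hzM hz]
    exact h.hasFDerivAt hz
  have hshift : HasFDerivAt (fun v : T => z + (v : E)) T.subtypeL 0 :=
    T.subtypeL.hasFDerivAt.const_add z
  have hnormal := (hshift.sub (hp.comp (0 : T) hshift)).isLittleO
  have hU : ∀ᶠ v : T in 𝓝 0, z + v ∈ U :=
    hshift.continuousAt.eventually (h.isOpen.mem_nhds (by simpa using hz))
  rw [hasGradientAt_iff_hasFDerivAt, map_zero, hasFDerivAt_iff_isLittleO]
  refine (Asymptotics.IsBigO.of_bound 1 ?_).trans_isLittleO hnormal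
  filter_upwards [hU] with v hv
  simp [h.infDist_eq hv, closestPoint_eq_self hzM, Metric.infDist_zero_of_mem hzM,
    Submodule.starProjection_eq_self_iff.mpr v.2]

theorem isLittleO_starProjection_orthogonal_sub (h : HasSmoothProjection M U) (hzM : z ∈ M)
    (hz : z ∈ U) :
    (fun w => (tangentPlane M z)ᗮ.starProjection (w - z)) =o[𝓝[M] z] fun w => w - z := by
  have hp := (h.hasFDerivAt hz).isLittleO.mono (nhdsWithin_le_nhds (s := M))
  rw [h.fderiv_eq_starProjection hzM hz] at hp
  refine hp.congr' ?_ .rfl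
  filter_upwards [self_mem_nhdsWithin] with w hw
  rw [closestPoint_eq_self hw, closestPoint_eq_self hzM, Submodule.starProjection_orthogonal]
  rfl

variable [MeasurableSpace E] [BorelSpace E]

theorem ae_norm_gradientAlong_infDist_sq_le (h : HasSmoothProjection M U) {m : ℕ} {Ω : Set E}
    (hΩ : IsOpen Ω) (V : IntegralVarifold m Ω)
    (hdim : ∀ q ∈ M, q ∈ U → Module.finrank ℝ (tangentPlane M q) = m)
    (hV : ∀ᵐ z ∂V.weight, z ∈ U ∧ closestPoint M z ∈ U) :
    ∀ᵐ z ∂V.weight,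
      DifferentiableAlong (V.tangent z) (fun w => Metric.infDist w M) z ∧
      ‖gradientAlong (V.tangent z) (fun w => Metric.infDist w M) z‖ ^ 2 ≤
        planeDistSq (V.tangent z) (tangentPlane M (closestPoint M z)) := by
  have htangent := V.ae_tangent_eq hΩ h.measurableSet_inter (T' := tangentPlane M)
    (fun z hz _ => hdim z hz.1 hz.2) fun z hz _ =>
      (h.isLittleO_starProjection_orthogonal_sub hz.1 hz.2).mono
        (nhdsWithin_mono z inter_subset_left)
  filter_upwards [hV, htangent] with z ⟨hz, hpz⟩ hT
  by_cases hd : Metric.infDist z M = 0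
  · have hzp : z = closestPoint M z := by
      rwa [h.infDist_eq hz, norm_sub_eq_zero_iff] at hd
    have hzM : z ∈ M := hzp ▸ h.closestPoint_mem hz
    have hgrad := h.hasGradientAt_infDist_tangentPlane hzM hz
    rw [← hT ⟨hzM, hz⟩] at hgrad
    refine ⟨hgrad.differentiableAt, ?_⟩
    rw [gradientAlong, hgrad.gradient, norm_zero, zero_pow two_ne_zero]
    exact planeDistSq_nonneg _ _
  · exact h.norm_gradientAlong_infDist_sq_le hz hpz hd (V.tangent z)

end HasSmoothProjection

end DistanceAlong

section TiltExcess

theorem lintegral_le_of_le_add_of_integral_eq_zero {α : Type*} [MeasurableSpace α] {μ : Measure α}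
    {f G h : α → ℝ} (hG : Integrable G μ) (hG₀ : ∫ z, G z ∂μ = 0) (hf : ∀ z, 0 ≤ f z)
    (hh : ∀ z, 0 ≤ h z) (hle : ∀ᵐ z ∂μ, f z ≤ G z + h z) :
    ∫⁻ z, ENNReal.ofReal (f z) ∂μ ≤ ∫⁻ z, ENNReal.ofReal (h z) ∂μ := by
  have hfin : ∫⁻ z, ENNReal.ofReal (-G z) ∂μ ≠ ⊤ := hG.neg.lintegral_lt_top.ne
  have heq : ∫⁻ z, ENNReal.ofReal (G z) ∂μ = ∫⁻ z, ENNReal.ofReal (-G z) ∂μ := by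
    rw [integral_eq_lintegral_pos_part_sub_lintegral_neg_part hG, sub_eq_zero] at hG₀
    exact (ENNReal.toReal_eq_toReal_iff' hG.lintegral_lt_top.ne hfin).mp hG₀
  have hpointwise : ∀ᵐ z ∂μ, ENNReal.ofReal (f z) + ENNReal.ofReal (-G z) ≤
      ENNReal.ofReal (G z) + ENNReal.ofReal (h z) := by
    filter_upwards [hle] with z hz
    rcases le_total 0 (G z) with hGz | hGz
    · rw [ENNReal.ofReal_of_nonpos (neg_nonpos.mpr hGz), add_zero,
        ← ENNReal.ofReal_add hGz (hh z)]
      exact ENNReal.ofReal_le_ofReal hz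
    · rw [ENNReal.ofReal_of_nonpos hGz, zero_add,
        ← ENNReal.ofReal_add (hf z) (neg_nonneg.mpr hGz)]
      exact ENNReal.ofReal_le_ofReal (by linarith)
  have hneg : AEMeasurable (fun z => ENNReal.ofReal (-G z)) μ :=
    hG.aemeasurable.neg.ennreal_ofReal
  have hint := lintegral_mono_ae hpointwise
  rw [lintegral_add_right' _ hneg, lintegral_add_left' hG.aemeasurable.ennreal_ofReal, heq,
    add_comm] at hint
  exact (ENNReal.add_le_add_iff_left hfin).mp hint

theorem neg_mul_le_of_sq_le_mul {s t a b : ℝ} (ha : 0 ≤ a) (hb : 0 ≤ b) (ht : t ^ 2 ≤ a * b) :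
    -(s * t) ≤ s ^ 2 * a / 16 + 4 * b := by
  have hsq : (s * t) ^ 2 ≤ (s ^ 2 * a / 16 + 4 * b) ^ 2 := calc
    (s * t) ^ 2 = s ^ 2 * t ^ 2 := mul_pow s t 2
    _ ≤ s ^ 2 * (a * b) := by gcongr
    _ ≤ (s ^ 2 * a / 16 + 4 * b) ^ 2 := by linarith [sq_nonneg (s ^ 2 * a / 16 - 4 * b)]
  linarith [(abs_le_of_sq_le_sq' hsq (by positivity)).1]

variable {E : Type*} [NormedAddCommGroup E] [InnerProductSpace ℝ E] [FiniteDimensional ℝ E]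

theorem exists_contDiff_cutoff {K O : Set E} (hK : IsCompact K) (hO : IsOpen O) (hKO : K ⊆ O) :
    ∃ χ : E → ℝ, ContDiff ℝ ∞ χ ∧ HasCompactSupport χ ∧ tsupport χ ⊆ O ∧
      ∀ z ∈ K, χ =ᶠ[𝓝 z] 1 := by
  obtain ⟨W, hW, hKW, hWO, hWc⟩ := exists_open_between_and_isCompact_closure hK hO hKO
  obtain ⟨χ, h₀, h₁, -⟩ := exists_contMDiffMap_zero_one_nhds_of_isClosed (n := ⊤)
    (modelWithCornersSelf ℝ E) hW.isClosed_compl hK.isClosed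
    (disjoint_left.mpr fun z hz hzK => hz (hKW hzK))
  have hχW : Function.support χ ⊆ W := fun z hz => by
    by_contra hzW
    exact hz (h₀.filter_mono (nhds_le_nhdsSet hzW)).self_of_nhds
  exact ⟨χ, χ.contMDiff.contDiff, hWc.of_isClosed_subset (isClosed_tsupport _) (closure_mono hχW),
    (closure_mono hχW).trans hWO, fun z hz => h₁.filter_mono (nhds_le_nhdsSet hz)⟩

theorem divAlong_eq_sum_inner (T : Submodule ℝ E) (Z : E → E) (z : E) :
    divAlong T Z z = ∑ i, inner ℝ (T.starProjection (stdOrthonormalBasis ℝ E i))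
      (fderiv ℝ Z z (stdOrthonormalBasis ℝ E i)) := by
  refine (clmTrace_eq_sum_inner (stdOrthonormalBasis ℝ E)
    (T.starProjection * fderiv ℝ Z z)).trans (Finset.sum_congr rfl fun i _ => ?_)
  exact (Submodule.inner_starProjection_left_eq_right T _ _).symm

theorem divAlong_congr {T : Submodule ℝ E} {Z Z' : E → E} {z : E} (h : Z =ᶠ[𝓝 z] Z') :
    divAlong T Z z = divAlong T Z' z := by
  rw [divAlong, divAlong, h.fderiv_eq]

namespace IntegralVarifold

variable [MeasurableSpace E] [BorelSpace E] {m : ℕ} {Ω : Set E} {V : IntegralVarifold m Ω}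

theorem integrable_divAlong {Z : E → E} (hZ : ContDiff ℝ 1 Z) (hc : HasCompactSupport Z)
    (hs : tsupport Z ⊆ Ω) : Integrable (fun z => divAlong (V.tangent z) Z z) V.weight := by
  have hcont : Continuous (fderiv ℝ Z) := hZ.continuous_fderiv one_ne_zero
  obtain ⟨C, hC⟩ := hcont.bounded_above_of_compact_support (hc.fderiv (𝕜 := ℝ))
  simp only [divAlong_eq_sum_inner]
  refine integrable_finsetSum _ fun i _ => ?_
  have hnorm : ‖stdOrthonormalBasis ℝ E i‖ = 1 := (stdOrthonormalBasis ℝ E).norm_eq_one i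
  refine integrable_of_support_subset (s := tsupport Z) (C := C)
    (V.finite_on_compacts _ hs hc) ?_ (fun z => ?_) fun z => ?_
  · exact (V.measurable_tangent _).aestronglyMeasurable.inner
      (hcont.clm_apply continuous_const).aestronglyMeasurable
  · refine (norm_inner_le_norm (𝕜 := ℝ) _ _).trans ?_
    calc _ ≤ ‖stdOrthonormalBasis ℝ E i‖ * (‖fderiv ℝ Z z‖ * ‖stdOrthonormalBasis ℝ E i‖) :=
          mul_le_mul (Submodule.norm_starProjection_apply_le _ _)
            ((fderiv ℝ Z z).le_opNorm _) (norm_nonneg _) (norm_nonneg _)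
      _ ≤ C := by simpa [hnorm] using hC z
  · contrapose
    intro hz
    simp [fderiv_of_notMem_tsupport ℝ hz]

/-- Only the values near `spt ‖V‖` matter, so a test field may be cut off away from it. -/
theorem IsStationary.integrable_and_integral_divAlong_eq_zero (hV : V.IsStationary) {O : Set E}
    (hO : IsOpen O) (hOΩ : O ⊆ Ω) {Z : E → E} (hZ : ContDiffOn ℝ ∞ Z O)
    (hc : IsCompact (tsupport Z ∩ V.weight.support)) (hs : tsupport Z ∩ V.weight.support ⊆ O) :
    Integrable (fun z => divAlong (V.tangent z) Z z) V.weight ∧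
      ∫ z, divAlong (V.tangent z) Z z ∂V.weight = 0 := by
  obtain ⟨χ, hχ, hχc, hχO, hχ₁⟩ := exists_contDiff_cutoff hc hO hs
  have hsub : tsupport (fun w => χ w • Z w) ⊆ O :=
    (closure_mono (Function.support_smul_subset_left χ Z)).trans hχO
  have hsmooth : ContDiff ℝ ∞ fun w => χ w • Z w := contDiff_iff_contDiffAt.mpr fun z => by
    by_cases hz : z ∈ tsupport fun w => χ w • Z w
    · exact hχ.contDiffAt.smul (hZ.contDiffAt (hO.mem_nhds (hsub hz)))
    · exact contDiffAt_const.congr_of_eventuallyEq (notMem_tsupport_iff_eventuallyEq.mp hz)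
  have hdiv : ∀ᵐ z ∂V.weight, divAlong (V.tangent z) (fun w => χ w • Z w) z =
      divAlong (V.tangent z) Z z := by
    filter_upwards [V.weight.support_mem_ae] with z hz
    refine divAlong_congr ?_
    by_cases hzZ : z ∈ tsupport Z
    · filter_upwards [hχ₁ z ⟨hzZ, hz⟩] with w hw
      rw [hw, Pi.one_apply, one_smul]
    · filter_upwards [notMem_tsupport_iff_eventuallyEq.mp hzZ] with w hw
      rw [hw, Pi.zero_apply, smul_zero]
  refine ⟨(integrable_divAlong (hsmooth.of_le (mod_cast le_top)) hχc.smul_right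
    (hsub.trans hOΩ)).congr hdiv, ?_⟩
  rw [← integral_congr_ae hdiv]
  exact hV _ hsmooth hχc.smul_right (hsub.trans hOΩ)

end IntegralVarifold

namespace HasSmoothProjection

variable {M U : Set E} {z : E} {ζ : E → ℝ} {K : ℝ}

theorem divAlong_sq_smul_sub_closestPoint (h : HasSmoothProjection M U) (hz : z ∈ U)
    (hζ : DifferentiableAt ℝ ζ z) (T : Submodule ℝ E) :
    divAlong T (fun w => ζ w ^ 2 • (w - closestPoint M w)) z =
      ζ z ^ 2 * laplacianAlong T (fun w => Metric.infDist w M ^ 2 / 2) z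
        + 2 * (ζ z * fderiv ℝ ζ z (T.starProjection (z - closestPoint M z))) := by
  set L := fderiv ℝ (closestPoint M) z
  set ν := z - closestPoint M z
  set ℓ := (2 * ζ z) • fderiv ℝ ζ z
  have hfield : HasFDerivAt (fun w => ζ w ^ 2 • (w - closestPoint M w))
      (ζ z ^ 2 • (1 - L) + ℓ.smulRight ν) z := by
    refine ((hζ.hasFDerivAt.pow 2).smul ((hasFDerivAt_id z).sub (h.hasFDerivAt hz))).congr_fderiv ?_
    simp [ℓ, L, ν, ContinuousLinearMap.one_def]
  have hmul : T.starProjection * ℓ.smulRight ν = ℓ.smulRight (T.starProjection ν) := by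
    ext1 v
    exact map_smul T.starProjection (ℓ v) ν
  calc divAlong T (fun w => ζ w ^ 2 • (w - closestPoint M w)) z
    _ = clmTrace E (T.starProjection * (ζ z ^ 2 • (1 - L) + ℓ.smulRight ν)) := by
      rw [← hfield.fderiv]
      rfl
    _ = ζ z ^ 2 * clmTrace E (T.starProjection * (1 - L)) + ℓ (T.starProjection ν) := by
      rw [mul_add, map_add, hmul, clmTrace_smulRight, mul_smul_comm, map_smul, smul_eq_mul]
    _ = _ := by
      rw [h.laplacianAlong_infDist_sq_div_two hz, smul_apply, smul_eq_mul, mul_assoc]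

theorem sq_mul_planeDistSq_le (h : HasSmoothProjection M U) (hz : z ∈ U)
    (hpz : closestPoint M z ∈ U) {T : Submodule ℝ E}
    (hT : Module.finrank ℝ T = Module.finrank ℝ (tangentPlane M (closestPoint M z)))
    (hII : secondFundamentalFormNorm M (closestPoint M z) ≤ 1)
    (hd : secondFundamentalFormNorm M (closestPoint M z) * Metric.infDist z M ≤ 1 / 2)
    (hζ : DifferentiableAt ℝ ζ z) (hζ₁ : |ζ z| ≤ 1) (hK : ‖fderiv ℝ ζ z‖ ≤ K) :
    ζ z ^ 2 * planeDistSq T (tangentPlane M (closestPoint M z)) ≤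
      8 * divAlong T (fun w => ζ w ^ 2 • (w - closestPoint M w)) z
        + (64 * K ^ 2 + 16) * (Metric.infDist z M ^ 2 +
          Metric.infDist z M * ‖meanCurvature M (closestPoint M z)‖) := by
  have hlap := h.laplacianAlong_infDist_sq_ge hz hpz hT hII hd
  have hnormal := norm_starProjection_sq_le_planeDistSq_mul T
    (h.sub_closestPoint_mem_orthogonal hz hpz)
  rw [← h.infDist_eq hz] at hnormal
  rw [h.divAlong_sq_smul_sub_closestPoint hz hζ]
  set τ := planeDistSq T (tangentPlane M (closestPoint M z))
  set H := ‖meanCurvature M (closestPoint M z)‖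
  set d := Metric.infDist z M
  set κ := secondFundamentalFormNorm M (closestPoint M z)
  set Λ := laplacianAlong T (fun w => Metric.infDist w M ^ 2 / 2) z
  set t := fderiv ℝ ζ z (T.starProjection (z - closestPoint M z))
  set s := ζ z
  have hτ : 0 ≤ τ := planeDistSq_nonneg _ _
  have hd₀ : 0 ≤ d := Metric.infDist_nonneg
  have ht : t ^ 2 ≤ τ * (K ^ 2 * d ^ 2) := calc
    t ^ 2 ≤ (K * ‖T.starProjection (z - closestPoint M z)‖) ^ 2 :=
      sq_le_sq' (neg_le_of_abs_le ((fderiv ℝ ζ z).le_of_opNorm_le hK _))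
        (le_of_abs_le ((fderiv ℝ ζ z).le_of_opNorm_le hK _))
    _ = K ^ 2 * ‖T.starProjection (z - closestPoint M z)‖ ^ 2 := mul_pow _ _ 2
    _ ≤ K ^ 2 * (τ * d ^ 2) := by gcongr
    _ = τ * (K ^ 2 * d ^ 2) := mul_left_comm _ _ _
  have hcross : -(s * t) ≤ s ^ 2 * τ / 16 + 4 * (K ^ 2 * d ^ 2) :=
    neg_mul_le_of_sq_le_mul hτ (by positivity) ht
  have hs : s ^ 2 ≤ 1 := (sq_le_one_iff_abs_le_one s).mpr hζ₁
  have hlap' : s ^ 2 * (τ / 4 - H * d - 2 * κ * d ^ 2) ≤ s ^ 2 * Λ := by gcongr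
  have hH : s ^ 2 * (H * d) ≤ 1 * (H * d) := by gcongr
  have hκ : s ^ 2 * (κ * d ^ 2) ≤ 1 * (1 * d ^ 2) := by
    have : 0 ≤ κ := Real.sqrt_nonneg _
    gcongr
  have : 0 ≤ K ^ 2 * (d * H) := by positivity
  have : 0 ≤ H * d := by positivity
  linarith

variable [MeasurableSpace E] [BorelSpace E]

theorem lintegral_planeDistSq_le (h : HasSmoothProjection M U) {m : ℕ} {Ω A : Set E}
    (hΩ : IsOpen Ω) {V : IntegralVarifold m Ω} (hV : V.IsStationary)
    (hVU : ∀ᵐ z ∂V.weight, z ∈ U ∧ closestPoint M z ∈ U)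
    (hdim : ∀ q ∈ M, q ∈ U → Module.finrank ℝ (tangentPlane M q) = m)
    (hII : ∀ᵐ z ∂V.weight, secondFundamentalFormNorm M (closestPoint M z) ≤ 1 ∧
      secondFundamentalFormNorm M (closestPoint M z) * Metric.infDist z M ≤ 1 / 2)
    (hζ : ContDiff ℝ ∞ ζ) (hζ₁ : ∀ z, |ζ z| ≤ 1) (hK : ∀ z, ‖fderiv ℝ ζ z‖ ≤ K)
    (hc : IsCompact (tsupport ζ ∩ V.weight.support))
    (hs : tsupport ζ ∩ V.weight.support ⊆ Ω ∩ U)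
    (hA : MeasurableSet A) (hζA : ∀ z ∈ A, ζ z = 1) :
    ∫⁻ z in A, ENNReal.ofReal
        (planeDistSq (V.tangent z) (tangentPlane M (closestPoint M z))) ∂V.weight ≤
      ENNReal.ofReal (64 * K ^ 2 + 16) * ∫⁻ z in Ω, ENNReal.ofReal
        (Metric.infDist z M ^ 2 +
          Metric.infDist z M * ‖meanCurvature M (closestPoint M z)‖) ∂V.weight := by
  set τ : E → ℝ := fun z => planeDistSq (V.tangent z) (tangentPlane M (closestPoint M z))
  set F : E → ℝ := fun z =>
    Metric.infDist z M ^ 2 + Metric.infDist z M * ‖meanCurvature M (closestPoint M z)‖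
  have hF (z : E) : 0 ≤ F z := add_nonneg (sq_nonneg _)
    (mul_nonneg Metric.infDist_nonneg (norm_nonneg _))
  set Z : E → E := fun w => ζ w ^ 2 • (w - closestPoint M w)
  have hZζ : tsupport Z ⊆ tsupport ζ := closure_mono fun w hw hζw => hw (by simp [Z, hζw])
  have hZ : ContDiffOn ℝ ∞ Z (Ω ∩ U) := ((hζ.pow 2).contDiffOn.smul
    (contDiffOn_id.sub h.contDiffOn)).mono inter_subset_right
  have hZc : IsCompact (tsupport Z ∩ V.weight.support) :=
    hc.of_isClosed_subset ((isClosed_tsupport Z).inter Measure.isClosed_support)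
      (inter_subset_inter_left _ hZζ)
  obtain ⟨hint, hzero⟩ := hV.integrable_and_integral_divAlong_eq_zero (hΩ.inter h.isOpen)
    inter_subset_left hZ hZc ((inter_subset_inter_left _ hZζ).trans hs)
  have hpointwise : ∀ᵐ z ∂V.weight,
      ζ z ^ 2 * τ z ≤ 8 * divAlong (V.tangent z) Z z + (64 * K ^ 2 + 16) * F z := by
    filter_upwards [hVU, hII] with z ⟨hz, hpz⟩ ⟨hII₁, hII₂⟩
    exact h.sq_mul_planeDistSq_le hz hpz
      (by rw [V.finrank_tangent, hdim _ (h.closestPoint_mem hz) hpz]) hII₁ hII₂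
      (hζ.differentiable (by simp) z) (hζ₁ z) (hK z)
  have hΩ_ae : V.weight.restrict Ω = V.weight :=
    Measure.restrict_eq_self_of_ae_mem (V.ae_mem_carrier.mono fun _ hz => V.carrier_subset hz)
  rw [hΩ_ae, ← lintegral_const_mul' _ _ ENNReal.ofReal_ne_top]
  calc ∫⁻ z in A, ENNReal.ofReal (τ z) ∂V.weight
    _ = ∫⁻ z in A, ENNReal.ofReal (ζ z ^ 2 * τ z) ∂V.weight :=
      setLIntegral_congr_fun hA fun z hz => by simp only [hζA z hz, one_pow, one_mul]
    _ ≤ ∫⁻ z, ENNReal.ofReal (ζ z ^ 2 * τ z) ∂V.weight := setLIntegral_le_lintegral _ _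
    _ ≤ ∫⁻ z, ENNReal.ofReal ((64 * K ^ 2 + 16) * F z) ∂V.weight :=
      lintegral_le_of_le_add_of_integral_eq_zero (hint.const_mul 8)
        (by rw [integral_const_mul, hzero, mul_zero])
        (fun z => mul_nonneg (sq_nonneg _) (planeDistSq_nonneg _ _))
        (fun z => mul_nonneg (by positivity) (hF z)) hpointwise
    _ = _ := lintegral_congr fun z => ENNReal.ofReal_mul (by positivity)

end HasSmoothProjection

end TiltExcess

theorem exists_contDiff_cylinder_cutoff (X Y : Type*) [NormedAddCommGroup X]
    [InnerProductSpace ℝ X] [FiniteDimensional ℝ X] [NormedAddCommGroup Y]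
    [InnerProductSpace ℝ Y] :
    ∃ (K : ℝ) (ζ : WithLp 2 (X × Y) → ℝ), ContDiff ℝ ∞ ζ ∧ (∀ z, |ζ z| ≤ 1) ∧
      (∀ z, ‖fderiv ℝ ζ z‖ ≤ K) ∧ (∀ z, ‖z.fst‖ < 1 / 2 → ζ z = 1) ∧
      ∀ z ∈ tsupport ζ, ‖z.fst‖ < 1 := by
  let ζ : ContDiffBump (0 : X) := ⟨1 / 2, 3 / 4, by norm_num, by norm_num⟩
  have hζ : ContDiff ℝ 1 ζ := ζ.contDiff
  obtain ⟨K, hK⟩ := (hζ.continuous_fderiv one_ne_zero).bounded_above_of_compact_support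
    (ζ.hasCompactSupport.fderiv (𝕜 := ℝ))
  have hderiv (z : WithLp 2 (X × Y)) : fderiv ℝ (fun w : WithLp 2 (X × Y) => ζ w.fst) z =
      fderiv ℝ ζ z.fst ∘L WithLp.fstL 2 ℝ X Y :=
    ((hζ.differentiable one_ne_zero z.fst).hasFDerivAt.comp z
      (WithLp.fstL 2 ℝ X Y).hasFDerivAt).fderiv
  refine ⟨K, fun z => ζ z.fst, ζ.contDiff.comp (WithLp.fstL 2 ℝ X Y).contDiff,
    fun z => (abs_of_nonneg ζ.nonneg).trans_le ζ.le_one, fun z => ?_,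
    fun z hz => ζ.one_of_mem_closedBall (mem_closedBall_zero_iff.mpr hz.le), fun z hz => ?_⟩
  · rw [hderiv]
    refine ContinuousLinearMap.opNorm_le_bound _ ((norm_nonneg _).trans (hK z.fst)) fun v => ?_
    exact (ContinuousLinearMap.le_of_opNorm_le _ (hK z.fst) _).trans
      (mul_le_mul_of_nonneg_left (WithLp.norm_fst_le _ v) ((norm_nonneg _).trans (hK z.fst)))
  · have hsupp : tsupport (fun w : WithLp 2 (X × Y) => ζ w.fst) ⊆ {w | ‖w.fst‖ ≤ 3 / 4} :=
      closure_minimal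
        (fun w hw => (mem_ball_zero_iff.mp (ζ.support_eq ▸ hw : w.fst ∈ Metric.ball 0 _)).le)
        (isClosed_le (WithLp.continuous_fst 2 X Y).norm continuous_const)
    exact (hsupp hz : ‖z.fst‖ ≤ 3 / 4).trans_lt (by norm_num)

theorem IsSmallGraph.secondFundamentalFormNorm_closestPoint_bounds {X Y : Type*}
    [NormedAddCommGroup X] [InnerProductSpace ℝ X] [FiniteDimensional ℝ X]
    [NormedAddCommGroup Y] [InnerProductSpace ℝ Y] [FiniteDimensional ℝ Y] {g : X → Y} {δ : ℝ}
    {z : WithLp 2 (X × Y)} (hg : IsSmallGraph g δ) (hδ : Module.finrank ℝ X * δ ≤ 1 / 2)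
    (hz : z ∈ largeSlab X Y) (hpz : closestPoint (graphOver g) z ∈ largeSlab X Y) :
    secondFundamentalFormNorm (graphOver g) (closestPoint (graphOver g) z) ≤ 1 ∧
      secondFundamentalFormNorm (graphOver g) (closestPoint (graphOver g) z) *
        Metric.infDist z (graphOver g) ≤ 1 / 2 := by
  have hII :=
    hg.secondFundamentalFormNorm_le (hg.hasSmoothProjection.closestPoint_mem hz) hpz
  refine ⟨by linarith, ?_⟩
  calc _ ≤ 1 / 4 * 2 := mul_le_mul (by linarith) (hg.infDist_lt_two hz).le
        Metric.infDist_nonneg (by norm_num)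
    _ = 1 / 2 := by norm_num

section Slab

variable {m n : ℕ}

theorem unitSlab_subset_largeSlab :
    unitSlab m n ⊆ largeSlab (EuclideanSpace ℝ (Fin m)) (EuclideanSpace ℝ (Fin n)) :=
  fun z hz => ⟨by linarith [hz.1], by linarith [hz.2]⟩

theorem isBounded_unitSlab : Bornology.IsBounded (unitSlab m n) :=
  (Metric.isBounded_ball (x := 0) (r := 2)).subset fun z hz => mem_ball_zero_iff.mpr <|
    (norm_le_norm_fst_add_norm_snd z).trans_lt (by linarith [hz.1, hz.2])

theorem isOpen_openCylinder (r : ℝ) : IsOpen (openCylinder m n r) :=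
  isOpen_lt (WithLp.continuous_fst 2 _ _).norm continuous_const

variable {V : IntegralVarifold m (openCylinder m n 1)}

theorem inter_support_subset_of_supp_subset (hV : V.supp ⊆ unitSlab m n) {F : Set (Ambient m n)}
    (hF : F ⊆ openCylinder m n 1) : F ∩ V.weight.support ⊆ unitSlab m n :=
  fun _ hz => hV ⟨hF hz.1, hz.2⟩

theorem isCompact_inter_support_of_supp_subset (hV : V.supp ⊆ unitSlab m n)
    {F : Set (Ambient m n)} (hF : F ⊆ openCylinder m n 1) (hFc : IsClosed F) :
    IsCompact (F ∩ V.weight.support) :=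
  Metric.isCompact_of_isClosed_isBounded (hFc.inter Measure.isClosed_support)
    (isBounded_unitSlab.subset (inter_support_subset_of_supp_subset hV hF))

theorem IsSmallGraph.ae_mem_largeSlab {g : EuclideanSpace ℝ (Fin m) → EuclideanSpace ℝ (Fin n)}
    {δ : ℝ} (hg : IsSmallGraph g δ) (hV : V.supp ⊆ unitSlab m n) :
    ∀ᵐ z ∂V.weight, z ∈ largeSlab _ _ ∧ closestPoint (graphOver g) z ∈ largeSlab _ _ :=
  V.ae_mem_supp.mono fun _ hz => ⟨unitSlab_subset_largeSlab (hV hz),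
    hg.closestPoint_mem_largeSlab (unitSlab_subset_largeSlab (hV hz)) (hV hz).1⟩

end Slab

end

theorem proposition2p6 (m n : ℕ) (hm : 1 ≤ m) (hn : 1 ≤ n) :
    ∃ C > (0 : ℝ), ∃ δ₀ > (0 : ℝ), ∀ δ ≤ δ₀, ∀ M : Set (Ambient m n),
      M ⊆ openCylinder m n 2 → IsSmoothSubmanifold M → IsFlatIn δ M 2 →
      -- the closest-point projection onto `M` is well defined on the slab
      (∀ z ∈ unitSlab m n, ∃! q, IsClosestPoint M z q) ∧
      ∀ V : IntegralVarifold m (openCylinder m n 1), V.IsStationary → V.supp ⊆ unitSlab m n →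
        -- `|D_V d_M|² ≤ |T_z V - T_{p(z)} M|²`
        (∀ᵐ z ∂V.weight,
          DifferentiableAlong (V.tangent z) (fun w => Metric.infDist w M) z ∧
          ‖gradientAlong (V.tangent z) (fun w => Metric.infDist w M) z‖ ^ 2 ≤
            planeDistSq (V.tangent z) (tangentPlane M (closestPoint M z))) ∧
        -- `Δ_V (d_M² / 2) ≥ |T_z V - T_{p(z)} M|² / 4 - |H| d_M - 2 |II| d_M²`
        (∀ᵐ z ∂V.weight,
          ContDiffAt ℝ ∞ (fun w => Metric.infDist w M ^ 2 / 2) z ∧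
          planeDistSq (V.tangent z) (tangentPlane M (closestPoint M z)) / 4
              - ‖meanCurvature M (closestPoint M z)‖ * Metric.infDist z M
              - 2 * secondFundamentalFormNorm M (closestPoint M z) * Metric.infDist z M ^ 2 ≤
            laplacianAlong (V.tangent z) (fun w => Metric.infDist w M ^ 2 / 2) z) ∧
        -- the tilt-excess inequality
        ∫⁻ z in openCylinder m n (1 / 2), ENNReal.ofReal
            (planeDistSq (V.tangent z) (tangentPlane M (closestPoint M z))) ∂V.weight ≤
          ENNReal.ofReal C * ∫⁻ z in openCylinder m n 1, ENNReal.ofReal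
            (Metric.infDist z M ^ 2 +
              Metric.infDist z M * ‖meanCurvature M (closestPoint M z)‖) ∂V.weight := by
  obtain ⟨K, ζ, hζ, hζ₁, hK, hζA, hζs⟩ := exists_contDiff_cylinder_cutoff
    (EuclideanSpace ℝ (Fin m)) (EuclideanSpace ℝ (Fin n))
  have hm₁ : (1 : ℝ) ≤ m := mod_cast hm
  refine ⟨64 * K ^ 2 + 16, by positivity, 1 / 20 / m, by positivity,
    fun δ hδ M hM hsmooth hflat => ?_⟩
  obtain ⟨g, hg, rfl⟩ :=
    hflat.exists_isSmallGraph (hδ.trans (div_le_self (by norm_num) hm₁)) hM hsmooth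
  have h := hg.hasSmoothProjection
  have hfin : Module.finrank ℝ (EuclideanSpace ℝ (Fin m)) = m := finrank_euclideanSpace_fin
  have hmδ : m * δ ≤ 1 / 20 := (le_div_iff₀' (by linarith)).mp hδ
  have hdim : ∀ q ∈ graphOver g, q ∈ largeSlab _ _ → _ = m := fun q hq _ =>
    (hg.finrank_tangentPlane hq).trans hfin
  refine ⟨fun z hz => hg.existsUnique_isClosestPoint (unitSlab_subset_largeSlab hz),
    fun V hV hsupp => ?_⟩
  have hslab := hg.ae_mem_largeSlab hsupp
  have hII := hslab.mono fun z hz =>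
    hg.secondFundamentalFormNorm_closestPoint_bounds (by rw [hfin]; linarith) hz.1 hz.2
  refine ⟨h.ae_norm_gradientAlong_infDist_sq_le (isOpen_openCylinder 1) V hdim hslab, ?_, ?_⟩
  · filter_upwards [hslab, hII] with z ⟨hz, hpz⟩ ⟨hII₁, hII₂⟩
    exact ⟨h.contDiffAt_infDist_sq_div_two hz, h.laplacianAlong_infDist_sq_ge hz hpz
      (by rw [V.finrank_tangent, hdim _ (h.closestPoint_mem hz) hpz]) hII₁ hII₂⟩
  · exact h.lintegral_planeDistSq_le (isOpen_openCylinder 1) hV hslab hdim hII hζ hζ₁ hK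
      (isCompact_inter_support_of_supp_subset hsupp hζs (isClosed_tsupport ζ))
      (subset_inter (fun z hz => hζs z hz.1)
        ((inter_support_subset_of_supp_subset hsupp hζs).trans unitSlab_subset_largeSlab))
      (isOpen_openCylinder _).measurableSet hζA
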